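/- Let $\lambda=(\lambda_1\ge\dots\ge\lambda_\ell>0)$ be a partition of $n$ and let $\mu=(\mu_1\ge\dots\ge\mu_k>0)$ be a nonempty partition, of length $k=\ell(\mu)\ge 1$. Let $s_\lambda[s_\mu]$ be the plethysm of Schur functions, that is, the symmetric function obtained from $s_\lambda(y_1,y_2,\ldots)$ by substituting for $y_1,y_2,\ldots$ the monomials $x^T$ of $s_\mu=\sum_T x^T$ ($T$ running over the semistandard Young tableaux of shape $\mu$), and let $$s_\lambda[s_\mu]=\sum_\nu a^\nu_{\lambda,\mu}\,s_\nu$$ be its (unique) expansion as a finite integer linear combination of Schur functions. Then the partition $\nu$ that is largest in lexicographic order among all partitions with $a^\nu_{\lambda,\mu}\neq 0$ is $$\nu=(n\mu_1,\ldots,n\mu_{k-1},\,n\mu_k-n+\lambda_1,\,\lambda_2,\ldots,\lambda_\ell).$$ Moreover, $a^\nu_{\lambda,\mu}=1$ for this $\nu$. (Partitions are identified up to trailing zeros, and $\lambda_1=0$ if $n=0$.) -/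

import Mathlib

/-- Content (weight) of a semistandard tableau: the exponent vector of its monomial
`x^T = ∏_{cells c} x_{T(c)}`. Entries, and hence variables, are indexed from `0`. -/
noncomputable def SemistandardYoungTableau.content {μ : YoungDiagram}
    (T : SemistandardYoungTableau μ) : ℕ →₀ ℕ :=
  ∑ c ∈ μ.cells, Finsupp.single (T c.1 c.2) 1

/-- The Schur function `s_μ = ∑_T x^T` in the variables `x_0, x_1, x_2, …`, with coefficients
in `R`: the sum runs over all semistandard tableaux `T` of shape `μ`, so the coefficient of `x^d`
is the (finite) number of those with content `d`. -/
noncomputable def schur (R : Type*) [Semiring R] (μ : YoungDiagram) : MvPowerSeries ℕ R :=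
  fun d => (Nat.card {T : SemistandardYoungTableau μ // T.content = d} : R)

/-- The terms of `g = ∑_d g_d x^d`, `g_d ∈ ℕ`, listed with multiplicity: the exponent `d`
occurs `g_d` times. -/
abbrev MonomialIndex (g : MvPowerSeries ℕ ℕ) : Type :=
  Σ d : ℕ →₀ ℕ, Fin (MvPowerSeries.coeff d g)

/-- The monomials of `g`, with multiplicity, arranged in a sequence `y_0, y_1, …`; positions that
are not used are filled with `0`. The enumeration chosen is irrelevant for symmetric functions. -/
noncomputable def monomialSeq (g : MvPowerSeries ℕ ℕ) : ℕ → MvPowerSeries ℕ ℤ :=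
  Function.extend (Countable.exists_injective_nat (MonomialIndex g)).choose
    (fun p => MvPowerSeries.monomial p.1 (1 : ℤ)) 0

/-- Plethysm `f[g] = f(y_0, y_1, …)` of a symmetric function `f` with a symmetric function `g`
which is a sum of monomials `y_0 + y_1 + ⋯` (without constant term): substitute the monomials
of `g`, taken with multiplicity, for the variables of `f`. -/
noncomputable def plethysm (f : MvPowerSeries ℕ ℤ) (g : MvPowerSeries ℕ ℕ) :
    MvPowerSeries ℕ ℤ :=
  MvPowerSeries.subst (monomialSeq g) f

/-- `f = ∑_ν a_ν s_ν`, a finite linear combination of Schur functions. -/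
def IsSchurExpansion (f : MvPowerSeries ℕ ℤ) (a : YoungDiagram →₀ ℤ) : Prop :=
  f = a.sum fun ν c => c • schur ℤ ν

/-- The `i`-th entry (counting from `0`) of the sequence
`(n μ_1, …, n μ_{k-1}, n μ_k - n + λ_1, λ_2, …, λ_ℓ, 0, 0, …)` with `n = |λ|`, `k = ℓ(μ) ≥ 1`.
The subtraction does not truncate since `μ_k ≥ 1`. -/
def leadingPart (lam μ : YoungDiagram) (i : ℕ) : ℕ :=
  if i + 1 < μ.colLen 0 then lam.card * μ.rowLen i
  else if i + 1 = μ.colLen 0 then lam.card * μ.rowLen i - lam.card + lam.rowLen 0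
  else lam.rowLen (i - μ.colLen 0 + 1)

/-!
The coefficient of `x ^ D` in `s_λ[s_μ]` is the sum of the Kostka numbers `K_{λ, e}` over all
multisets `e` of semistandard tableaux of shape `μ` whose contents add up to `D`
(`coeff_plethysm_schur`). No ordering of these tableaux matters, because Kostka numbers are
invariant under permutations of the letters (`kostka_mapDomain_eq`). That invariance comes from the
Bender–Knuth involution, which on Gelfand–Tsetlin patterns reflects each entry of one column in
the interval left to it by its neighbours.

Let `n = |λ|`, let `K` be the index of the last row of `μ` and let `e` be a multiset of tableaux
with `K_{λ, e} ≠ 0`, so that it has `n` members and no member occurs more than `λ_0` times. Partial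
sums of contents are bounded by those of `μ`. Hence the exponents of `x_0, …, x_{K-1}` are
lexicographically at most `n μ_0, …, n μ_{K-1}`, and equality forces them to be
`μ_0, …, μ_{K-1}` in every member of `e`. Then each member other than `x ^ μ` has exponent at most
`μ_K - 1` at `x_K`, so the total there is at most `n (μ_K - 1) + λ_0`
(`totalExponent_lastRow_le`). In the case of equality, `e` consists of `λ_0` copies of `x ^ μ` and
of tableaux in which the very last entry `K` is raised to some `K + j`, and the exponent of
`x_{K+j}` is the multiplicity of the `j`-th of these (`exists_eq_mapDomain_raisedIndex`). So
`e` is determined by `D`, and `K_{λ, e}` is the Kostka number of `λ` and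
`(λ_0, D_{K+1}, D_{K+2}, …)`. It vanishes if this vector exceeds `λ` lexicographically, and it is
`1` if the two are equal. Thus the claimed `ν` gives the largest monomial of `s_λ[s_μ]`, with
coefficient `1`.

The passage from monomials to Schur functions is the unitriangularity of the Kostka numbers in the
lexicographic order: it gives the existence and uniqueness of Schur expansions of homogeneous
symmetric power series (`exists_isSchurExpansion`, `IsSchurExpansion.unique`) and shows that the
leading Schur function and the leading monomial have the same coefficient
(`coeff_parts_sum_smul_schur`).
-/

/-! ### Partitions as exponent vectors -/

namespace YoungDiagram

theorem ext_rowLen {μ ν : YoungDiagram} (h : ∀ i, μ.rowLen i = ν.rowLen i) : μ = ν := by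
  ext ⟨i, j⟩
  rw [mem_cells, mem_cells, mem_iff_lt_rowLen, mem_iff_lt_rowLen, h]

theorem rowLen_pos_iff {μ : YoungDiagram} {i : ℕ} : 0 < μ.rowLen i ↔ i < μ.colLen 0 := by
  rw [← mem_iff_lt_rowLen, mem_iff_lt_colLen]

theorem rowLen_eq_zero {μ : YoungDiagram} {i : ℕ} (h : μ.colLen 0 ≤ i) : μ.rowLen i = 0 := by
  by_contra h0
  exact absurd (rowLen_pos_iff.1 (Nat.pos_of_ne_zero h0)) (not_lt.2 h)

/-- The parts of a partition as a finitely supported function, that is, as the exponent vector of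
the monomial `x_0 ^ μ_0 * x_1 ^ μ_1 * ⋯`. -/
noncomputable def parts (μ : YoungDiagram) : ℕ →₀ ℕ :=
  Finsupp.onFinset (Finset.range (μ.colLen 0)) μ.rowLen fun _ hi =>
    Finset.mem_range.2 (rowLen_pos_iff.1 (Nat.pos_of_ne_zero hi))

@[simp]
theorem parts_apply (μ : YoungDiagram) (i : ℕ) : μ.parts i = μ.rowLen i := rfl

/-- A set of cells of a Young diagram may be counted row by row. -/
theorem card_filter_cells (μ : YoungDiagram) {R : ℕ} (hR : μ.colLen 0 ≤ R) (p : ℕ × ℕ → Prop)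
    [DecidablePred p] :
    (μ.cells.filter p).card =
      ∑ r ∈ Finset.range R, ((Finset.range (μ.rowLen r)).filter fun c => p (r, c)).card := by
  rw [Finset.card_eq_sum_card_fiberwise (f := Prod.fst) (t := Finset.range R)]
  · refine Finset.sum_congr rfl fun r _ => ?_
    rw [← Finset.card_map (s := (Finset.range (μ.rowLen r)).filter fun c => p (r, c))
      ⟨Prod.mk r, Prod.mk_right_injective r⟩]
    congr 1
    ext ⟨a, b⟩
    simp only [Finset.mem_filter, mem_cells, mem_iff_lt_rowLen, Finset.mem_map,
      Finset.mem_range, Function.Embedding.coeFn_mk, Prod.mk.injEq]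
    constructor
    · rintro ⟨⟨h1, h2⟩, rfl⟩
      exact ⟨b, ⟨h1, h2⟩, rfl, rfl⟩
    · rintro ⟨c, ⟨h1, h2⟩, rfl, rfl⟩
      exact ⟨⟨h1, h2⟩, rfl⟩
  · rintro ⟨a, b⟩ h
    simp only [Finset.coe_filter, mem_cells, Set.mem_ofPred_eq, mem_iff_lt_rowLen] at h
    have : a < μ.colLen 0 := rowLen_pos_iff.1 (by omega)
    simp only [Finset.coe_range, Set.mem_Iio]
    omega

theorem card_eq_sum_rowLen (μ : YoungDiagram) {R : ℕ} (hR : μ.colLen 0 ≤ R) :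
    μ.card = ∑ r ∈ Finset.range R, μ.rowLen r := by
  simpa using μ.card_filter_cells hR (fun _ => True)

theorem sum_rowLen_le_card (μ : YoungDiagram) (t : ℕ) :
    ∑ r ∈ Finset.range t, μ.rowLen r ≤ μ.card := by
  rw [μ.card_eq_sum_rowLen (le_max_left (μ.colLen 0) t)]
  exact Finset.sum_le_sum_of_subset (Finset.range_mono (le_max_right _ _))

theorem degree_parts (μ : YoungDiagram) : μ.parts.degree = μ.card := by
  rw [Finsupp.degree_apply, μ.card_eq_sum_rowLen le_rfl]
  exact Finsupp.onFinset_sum _ (f := μ.rowLen) (g := fun _ x => x) fun _ => rfl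

/-- A weakly decreasing exponent vector is a partition. -/
theorem exists_parts_eq (d : ℕ →₀ ℕ) (h : ∀ i, d (i + 1) ≤ d i) :
    ∃ μ : YoungDiagram, μ.parts = d := by
  have hanti : Antitone d := antitone_nat_of_succ_le h
  let C : Finset (ℕ × ℕ) :=
    (d.support ×ˢ Finset.range (d 0)).filter fun c => c.2 < d c.1
  have hC : ∀ a b, (a, b) ∈ C ↔ b < d a := by
    intro a b
    simp only [C, Finset.mem_filter, Finset.mem_product, Finsupp.mem_support_iff,
      Finset.mem_range]
    have := hanti (Nat.zero_le a)
    omega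
  refine ⟨⟨C, ?_⟩, ?_⟩
  · rintro ⟨a, b⟩ ⟨a', b'⟩ hle hab
    obtain ⟨h1, h2⟩ := Prod.mk_le_mk.1 hle
    have h3 := (hC a b).1 hab
    have h4 := hanti h1
    exact (hC a' b').2 (by omega)
  · ext i
    rw [parts_apply]
    refine eq_of_forall_lt_iff fun c => ?_
    rw [← mem_iff_lt_rowLen]
    exact hC i c

/-- There are finitely many partitions of each size. -/
theorem finite_card_eq (m : ℕ) : {μ : YoungDiagram | μ.card = m}.Finite := by
  have hinj : Set.InjOn YoungDiagram.cells {μ : YoungDiagram | μ.card = m} :=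
    fun μ _ ν _ h => YoungDiagram.ext h
  refine Set.Finite.of_finite_image ?_ hinj
  refine (Finset.finite_toSet (Finset.range m ×ˢ Finset.range m).powerset).subset ?_
  rintro _ ⟨μ, hμ, rfl⟩
  simp only [Set.mem_ofPred_eq] at hμ
  rw [Finset.mem_coe, Finset.mem_powerset]
  rintro ⟨i, j⟩ hc
  -- The diagram contains the hook from `(i, 0)` over `(0, 0)` to `(0, j)`.
  have hcol : (Finset.range (i + 1)).image (fun a => (a, j)) ⊆ μ.cells := by
    intro c hc'
    obtain ⟨a, ha, rfl⟩ := Finset.mem_image.1 hc'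
    exact μ.up_left_mem (by rw [Finset.mem_range] at ha; omega) le_rfl hc
  have hrow : (Finset.range (j + 1)).image (fun b => (i, b)) ⊆ μ.cells := by
    intro c hc'
    obtain ⟨b, hb, rfl⟩ := Finset.mem_image.1 hc'
    exact μ.up_left_mem le_rfl (by rw [Finset.mem_range] at hb; omega) hc
  have h1 := Finset.card_le_card hcol
  have h2 := Finset.card_le_card hrow
  rw [Finset.card_image_of_injective _ (fun a b h => by simpa using h), Finset.card_range] at h1 h2
  have : μ.cells.card = m := hμ
  rw [Finset.mem_product, Finset.mem_range, Finset.mem_range]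
  omega

end YoungDiagram

/-! ### Counting entries of semistandard tableaux -/

namespace SemistandardYoungTableau

variable {μ : YoungDiagram} (T : SemistandardYoungTableau μ)

theorem content_apply (j : ℕ) :
    T.content j = (μ.cells.filter fun c => T c.1 c.2 = j).card := by
  simp only [content, Finsupp.finsetSum_apply, Finsupp.single_apply, Finset.card_filter]

theorem degree_content : T.content.degree = μ.card := by
  simp [content]

theorem sum_content (t : ℕ) :
    ∑ j ∈ Finset.range t, T.content j = (μ.cells.filter fun c => T c.1 c.2 < t).card := by
  simp_rw [content_apply]
  rw [Finset.card_eq_sum_card_fiberwise (f := fun c : ℕ × ℕ => T c.1 c.2) (t := Finset.range t)]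
  · refine Finset.sum_congr rfl fun j hj => ?_
    rw [Finset.filter_filter]
    congr 1
    refine Finset.filter_congr fun c _ => ?_
    rw [Finset.mem_range] at hj
    omega
  · intro c hc
    simpa using (Finset.mem_filter.1 hc).2

/-- The number of entries smaller than `t` in row `r`. As `t` varies, these numbers form the
Gelfand–Tsetlin pattern of the tableau. -/
def rowCount (r t : ℕ) : ℕ := ((Finset.range (μ.rowLen r)).filter fun c => T r c < t).card

theorem sum_content_eq_sum_rowCount (t : ℕ) {R : ℕ} (hR : μ.colLen 0 ≤ R) :
    ∑ j ∈ Finset.range t, T.content j = ∑ r ∈ Finset.range R, T.rowCount r t := by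
  rw [sum_content, μ.card_filter_cells hR]
  rfl

/-- The entries smaller than `t` form an initial segment of each row. -/
theorem lt_rowCount_iff {r t c : ℕ} : c < T.rowCount r t ↔ c < μ.rowLen r ∧ T r c < t := by
  set S := (Finset.range (μ.rowLen r)).filter fun c => T r c < t with hS
  have hmem : ∀ c, c ∈ S ↔ c < μ.rowLen r ∧ T r c < t := by simp [hS]
  rw [← hmem]
  have hlow : ∀ a b, a ≤ b → b ∈ S → a ∈ S := by
    intro a b hab hb
    rw [hmem] at hb ⊢
    have := T.row_weak_of_le hab (YoungDiagram.mem_iff_lt_rowLen.2 hb.1)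
    omega
  change c < S.card ↔ _
  constructor
  · intro hc
    by_contra hcS
    have : S ⊆ Finset.range c := fun b hb => by
      rw [Finset.mem_range]
      by_contra hbc
      exact hcS (hlow c b (by omega) hb)
    have := Finset.card_le_card this
    rw [Finset.card_range] at this
    omega
  · intro hc
    have : Finset.range (c + 1) ⊆ S := fun b hb => by
      rw [Finset.mem_range] at hb
      exact hlow b c (by omega) hc
    have := Finset.card_le_card this
    rw [Finset.card_range] at this
    omega

theorem rowCount_le_rowLen (r t : ℕ) : T.rowCount r t ≤ μ.rowLen r :=
  (Finset.card_filter_le _ _).trans (Finset.card_range _).le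

theorem rowCount_mono (r : ℕ) {s t : ℕ} (h : s ≤ t) : T.rowCount r s ≤ T.rowCount r t :=
  Finset.card_le_card (Finset.monotone_filter_right _ fun _ _ hc => lt_of_lt_of_le hc h)

theorem rowCount_zero (r : ℕ) : T.rowCount r 0 = 0 := by simp [rowCount]

/-- Column strictness in terms of Gelfand–Tsetlin patterns. -/
theorem rowCount_succ_succ_le (r t : ℕ) : T.rowCount (r + 1) (t + 1) ≤ T.rowCount r t := by
  refine le_of_forall_lt fun c hc => ?_
  rw [lt_rowCount_iff] at hc ⊢
  have h1 := T.col_strict (Nat.lt_succ_self r) (YoungDiagram.mem_iff_lt_rowLen.2 hc.1)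
  have h2 := μ.rowLen_anti r (r + 1) (Nat.le_succ r)
  simp only [Nat.succ_eq_add_one] at h1
  omega

theorem rowCount_eq_rowLen (r : ℕ) : ∃ t, T.rowCount r t = μ.rowLen r := by
  refine ⟨(∑ c ∈ Finset.range (μ.rowLen r), T r c) + 1, ?_⟩
  rw [rowCount, Finset.filter_true_of_mem, Finset.card_range]
  intro c hc
  exact Nat.lt_succ_of_le (Finset.single_le_sum (f := fun c => T r c) (fun _ _ => Nat.zero_le _) hc)

/-- A tableau is determined by its Gelfand–Tsetlin pattern. -/
theorem ext_rowCount {T T' : SemistandardYoungTableau μ}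
    (h : ∀ r t, T.rowCount r t = T'.rowCount r t) : T = T' := by
  ext r c
  by_cases hc : (r, c) ∈ μ
  · rw [YoungDiagram.mem_iff_lt_rowLen] at hc
    refine eq_of_forall_gt_iff fun t => ?_
    have h1 := T.lt_rowCount_iff (r := r) (t := t) (c := c)
    have h2 := T'.lt_rowCount_iff (r := r) (t := t) (c := c)
    rw [h] at h1
    tauto
  · rw [T.zeros hc, T'.zeros hc]

/-- Every Gelfand–Tsetlin pattern whose limit shape is `μ` comes from a tableau. -/
theorem exists_rowCount_eq (N : ℕ → ℕ → ℕ) (h0 : ∀ r, N r 0 = 0)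
    (hmono : ∀ r t, N r t ≤ N r (t + 1)) (hcol : ∀ r t, N (r + 1) (t + 1) ≤ N r t)
    (hle : ∀ r t, N r t ≤ μ.rowLen r) (hlim : ∀ r, ∃ t, N r t = μ.rowLen r) :
    ∃ T : SemistandardYoungTableau μ, ∀ r t, T.rowCount r t = N r t := by
  classical
  have hmono' : ∀ r, Monotone (N r) := fun r => monotone_nat_of_le_succ (hmono r)
  -- The entry in column `c` of row `r` is the least `t` with `c < N r (t + 1)`.
  have hex : ∀ r c, (r, c) ∈ μ → ∃ t, c < N r (t + 1) := by
    intro r c hc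
    rw [YoungDiagram.mem_iff_lt_rowLen] at hc
    obtain ⟨t, ht⟩ := hlim r
    exact ⟨t, by have := hmono r t; omega⟩
  let E : ℕ → ℕ → ℕ := fun r c => if h : (r, c) ∈ μ then Nat.find (hex r c h) else 0
  have hE : ∀ r c t, (r, c) ∈ μ → (E r c < t ↔ c < N r t) := by
    intro r c t h
    simp only [E, h, dif_pos]
    rw [Nat.find_lt_iff]
    constructor
    · rintro ⟨m, hm, hc⟩
      exact hc.trans_le (hmono' r hm)
    · intro hc
      obtain _ | t := t
      · rw [h0] at hc; omega
      · exact ⟨t, Nat.lt_succ_self t, hc⟩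
  have hcol1 : ∀ r c, (r + 1, c) ∈ μ → E r c < E (r + 1) c := by
    intro r c h
    have h' : (r, c) ∈ μ := μ.up_left_mem (Nat.le_succ r) le_rfl h
    rw [hE r c _ h']
    have := (hE (r + 1) c (E (r + 1) c + 1) h).1 (Nat.lt_succ_self _)
    exact this.trans_le (hcol _ _)
  let T : SemistandardYoungTableau μ :=
    { entry := E
      row_weak' := by
        intro i j1 j2 hj h
        have h' : (i, j1) ∈ μ := μ.up_left_mem le_rfl hj.le h
        refine Nat.le_of_lt_succ ((hE i j1 _ h').2 (hj.trans ?_))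
        exact (hE i j2 _ h).1 (Nat.lt_succ_self _)
      col_strict' := by
        intro i1 i2 j hi h
        induction i2 with
        | zero => omega
        | succ i ih =>
          rcases Nat.lt_succ_iff_lt_or_eq.1 hi with hlt | rfl
          · exact (ih hlt (μ.up_left_mem (Nat.le_succ i) le_rfl h)).trans (hcol1 i j h)
          · exact hcol1 i1 j h
      zeros' := fun h => by simp only [E, h, dif_neg, not_false_iff] }
  refine ⟨T, fun r t => eq_of_forall_lt_iff fun c => ?_⟩
  rw [lt_rowCount_iff]
  constructor
  · rintro ⟨h1, h2⟩
    exact (hE r c t (YoungDiagram.mem_iff_lt_rowLen.2 h1)).1 h2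
  · intro h
    have h1 : c < μ.rowLen r := h.trans_le (hle r t)
    exact ⟨h1, (hE r c t (YoungDiagram.mem_iff_lt_rowLen.2 h1)).2 h⟩

end SemistandardYoungTableau

/-! ### The Bender–Knuth involution -/

namespace SemistandardYoungTableau

variable {μ : YoungDiagram} (T : SemistandardYoungTableau μ)

/-- Interlacing bounds `rowCount r (i + 1)` from below by this number, which depends only on
columns `i` and `i + 2` of the Gelfand–Tsetlin pattern. -/
def lowerCount (i r : ℕ) : ℕ := max (T.rowCount r i) (T.rowCount (r + 1) (i + 2))

/-- Interlacing bounds `rowCount r (i + 1)` from above by this number, which depends only on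
columns `i` and `i + 2` of the Gelfand–Tsetlin pattern. -/
def upperCount (i : ℕ) : ℕ → ℕ
  | 0 => T.rowCount 0 (i + 2)
  | r + 1 => min (T.rowCount (r + 1) (i + 2)) (T.rowCount r i)

theorem lowerCount_le (i r : ℕ) : T.lowerCount i r ≤ T.rowCount r (i + 1) :=
  max_le (T.rowCount_mono r (Nat.le_succ i)) (T.rowCount_succ_succ_le r (i + 1))

theorem le_upperCount (i r : ℕ) : T.rowCount r (i + 1) ≤ T.upperCount i r := by
  cases r with
  | zero => exact T.rowCount_mono 0 (Nat.le_succ (i + 1))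
  | succ r => exact le_min (T.rowCount_mono _ (Nat.le_succ (i + 1))) (T.rowCount_succ_succ_le r i)

theorem upperCount_le (i r : ℕ) : T.upperCount i r ≤ T.rowCount r (i + 2) := by
  cases r with
  | zero => exact le_rfl
  | succ r => exact min_le_left _ _

/-- Every entry of column `i + 1` of a Gelfand–Tsetlin pattern may be reflected in the interval
allowed by the interlacing conditions with the neighbouring columns. -/
theorem exists_benderKnuth (i : ℕ) : ∃ T' : SemistandardYoungTableau μ, ∀ r t,
    T'.rowCount r t = if t = i + 1 then T.lowerCount i r + T.upperCount i r - T.rowCount r (i + 1)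
      else T.rowCount r t := by
  have hb : ∀ r, T.rowCount r i ≤ T.lowerCount i r := fun r => le_max_left _ _
  have hb' : ∀ r, T.rowCount (r + 1) (i + 2) ≤ T.lowerCount i r := fun r => le_max_right _ _
  have ha' : ∀ r, T.upperCount i (r + 1) ≤ T.rowCount r i := fun r => min_le_right _ _
  refine exists_rowCount_eq _ (fun r => ?_) (fun r t => ?_) (fun r t => ?_) (fun r t => ?_)
    (fun r => ?_)
  · rw [if_neg (by omega), rowCount_zero]
  · have h1 := T.lowerCount_le i r
    have h2 := T.le_upperCount i r
    have h3 := T.upperCount_le i r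
    have h4 := hb r
    by_cases ht : t = i
    · subst ht
      rw [if_neg (by omega), if_pos rfl]
      omega
    · by_cases ht' : t = i + 1
      · subst ht'
        rw [if_pos rfl, if_neg (by omega)]
        have : i + 1 + 1 = i + 2 := rfl
        rw [this]
        omega
      · rw [if_neg ht', if_neg (by omega)]
        exact T.rowCount_mono r (Nat.le_succ t)
  · have h1 := T.lowerCount_le i r
    have h2 := T.le_upperCount i r
    have h1' := T.lowerCount_le i (r + 1)
    have h2' := T.le_upperCount i (r + 1)
    have h3 := ha' r
    have h4 := hb' r
    by_cases ht : t = i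
    · subst ht
      rw [if_pos rfl, if_neg (by omega)]
      omega
    · rw [if_neg (show ¬ t + 1 = i + 1 by omega)]
      by_cases ht' : t = i + 1
      · subst ht'
        rw [if_pos rfl]
        have : i + 1 + 1 = i + 2 := rfl
        rw [this]
        omega
      · rw [if_neg ht']
        exact T.rowCount_succ_succ_le r t
  · have h1 := T.lowerCount_le i r
    have h2 := T.le_upperCount i r
    have h3 := T.upperCount_le i r
    have h4 := T.rowCount_le_rowLen r (i + 2)
    split_ifs
    · omega
    · exact T.rowCount_le_rowLen r t
  · obtain ⟨t, ht⟩ := T.rowCount_eq_rowLen r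
    refine ⟨max t (i + 2), ?_⟩
    rw [if_neg (by omega)]
    exact le_antisymm (T.rowCount_le_rowLen _ _) (ht ▸ T.rowCount_mono r (le_max_left _ _))

/-- The Bender–Knuth involution, exchanging the multiplicities of the entries `i` and `i + 1`. -/
noncomputable def benderKnuth (i : ℕ) (T : SemistandardYoungTableau μ) :
    SemistandardYoungTableau μ :=
  (T.exists_benderKnuth i).choose

theorem rowCount_benderKnuth_of_ne {i t : ℕ} (r : ℕ) (h : t ≠ i + 1) :
    (T.benderKnuth i).rowCount r t = T.rowCount r t := by
  rw [benderKnuth, (T.exists_benderKnuth i).choose_spec, if_neg h]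

theorem rowCount_benderKnuth (i r : ℕ) :
    (T.benderKnuth i).rowCount r (i + 1) =
      T.lowerCount i r + T.upperCount i r - T.rowCount r (i + 1) := by
  rw [benderKnuth, (T.exists_benderKnuth i).choose_spec, if_pos rfl]

theorem benderKnuth_involutive (i : ℕ) :
    Function.Involutive (benderKnuth (μ := μ) i) := by
  intro T
  refine ext_rowCount fun r t => ?_
  by_cases ht : t = i + 1
  · subst ht
    have hl : (T.benderKnuth i).lowerCount i r = T.lowerCount i r := by
      simp only [lowerCount]
      rw [rowCount_benderKnuth_of_ne _ _ (by omega), rowCount_benderKnuth_of_ne _ _ (by omega)]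
    have hu : (T.benderKnuth i).upperCount i r = T.upperCount i r := by
      cases r <;> simp only [upperCount]
      · rw [rowCount_benderKnuth_of_ne _ _ (by omega)]
      · rw [rowCount_benderKnuth_of_ne _ _ (by omega), rowCount_benderKnuth_of_ne _ _ (by omega)]
    rw [rowCount_benderKnuth, hl, hu, rowCount_benderKnuth]
    have h1 := T.lowerCount_le i r
    have h2 := T.le_upperCount i r
    omega
  · rw [rowCount_benderKnuth_of_ne _ _ ht, rowCount_benderKnuth_of_ne _ _ ht]

theorem sum_content_benderKnuth_of_ne {i t : ℕ} (h : t ≠ i + 1) :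
    ∑ j ∈ Finset.range t, (T.benderKnuth i).content j = ∑ j ∈ Finset.range t, T.content j := by
  rw [sum_content_eq_sum_rowCount _ _ le_rfl, sum_content_eq_sum_rowCount _ _ le_rfl]
  exact Finset.sum_congr rfl fun r _ => T.rowCount_benderKnuth_of_ne r h

/-- The lower bound in row `r` and the upper bound in row `r + 1` are the maximum and the minimum
of the same two numbers, so the interval endpoints have the same sum as the neighbouring
columns. -/
theorem sum_lowerCount_add_sum_upperCount (i R : ℕ) :
    ∑ r ∈ Finset.range R, T.lowerCount i r + ∑ r ∈ Finset.range (R + 1), T.upperCount i r =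
      ∑ r ∈ Finset.range R, T.rowCount r i + ∑ r ∈ Finset.range (R + 1), T.rowCount r (i + 2) := by
  rw [Finset.sum_range_succ', Finset.sum_range_succ' (fun r => T.rowCount r (i + 2)),
    ← add_assoc, ← add_assoc, ← Finset.sum_add_distrib, ← Finset.sum_add_distrib]
  congr 1
  refine Finset.sum_congr rfl fun r _ => ?_
  simp only [lowerCount, upperCount]
  omega

theorem sum_content_benderKnuth (i : ℕ) :
    ∑ j ∈ Finset.range (i + 1), (T.benderKnuth i).content j +
        ∑ j ∈ Finset.range (i + 1), T.content j =
      ∑ j ∈ Finset.range i, T.content j + ∑ j ∈ Finset.range (i + 2), T.content j := by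
  have hR : μ.colLen 0 ≤ μ.colLen 0 + 1 := Nat.le_succ _
  rw [sum_content_eq_sum_rowCount _ _ hR, sum_content_eq_sum_rowCount _ _ hR,
    sum_content_eq_sum_rowCount _ _ le_rfl, sum_content_eq_sum_rowCount _ _ hR,
    ← sum_lowerCount_add_sum_upperCount, ← Finset.sum_add_distrib]
  have hlast : T.lowerCount i (μ.colLen 0) = 0 := by
    have h1 := T.lowerCount_le i (μ.colLen 0)
    have h2 := T.rowCount_le_rowLen (μ.colLen 0) (i + 1)
    have h3 := μ.rowLen_eq_zero le_rfl
    omega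
  have : ∑ r ∈ Finset.range (μ.colLen 0), T.lowerCount i r =
      ∑ r ∈ Finset.range (μ.colLen 0 + 1), T.lowerCount i r := by
    rw [Finset.sum_range_succ, hlast, add_zero]
  rw [this, ← Finset.sum_add_distrib]
  refine Finset.sum_congr rfl fun r _ => ?_
  rw [rowCount_benderKnuth]
  have h1 := T.lowerCount_le i r
  have h2 := T.le_upperCount i r
  omega

theorem content_benderKnuth (i : ℕ) :
    (T.benderKnuth i).content = T.content.mapDomain (Equiv.swap i (i + 1)) := by
  have key := T.sum_content_benderKnuth i
  have h0 := T.sum_content_benderKnuth_of_ne (i := i) (t := i) (by omega)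
  have h2 := T.sum_content_benderKnuth_of_ne (i := i) (t := i + 2) (by omega)
  have e2 : i + 2 = i + 1 + 1 := rfl
  simp only [e2, Finset.sum_range_succ] at key h0 h2
  ext j
  rw [Finsupp.mapDomain_equiv_apply, Equiv.symm_swap]
  by_cases hj : j = i
  · rw [hj, Equiv.swap_apply_left]
    omega
  by_cases hj' : j = i + 1
  · rw [hj', Equiv.swap_apply_right]
    omega
  · rw [Equiv.swap_apply_of_ne_of_ne hj hj']
    have h3 := T.sum_content_benderKnuth_of_ne (i := i) (t := j) hj'
    have h4 := T.sum_content_benderKnuth_of_ne (i := i) (t := j + 1) (by omega)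
    rw [Finset.sum_range_succ, Finset.sum_range_succ] at h4
    omega

end SemistandardYoungTableau

/-! ### Kostka numbers -/

/-- The Kostka number: the number of semistandard tableaux of shape `lam` and content `d`. -/
noncomputable def kostka (lam : YoungDiagram) (d : ℕ →₀ ℕ) : ℕ :=
  Nat.card {T : SemistandardYoungTableau lam // T.content = d}

theorem coeff_schur (R : Type*) [Semiring R] (lam : YoungDiagram) (d : ℕ →₀ ℕ) :
    MvPowerSeries.coeff d (schur R lam) = (kostka lam d : R) := rfl

theorem exists_content_eq_of_kostka_ne_zero {lam : YoungDiagram} {d : ℕ →₀ ℕ}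
    (h : kostka lam d ≠ 0) : ∃ T : SemistandardYoungTableau lam, T.content = d := by
  obtain ⟨⟨T, hT⟩⟩ := (Nat.card_ne_zero.1 h).1
  exact ⟨T, hT⟩

theorem kostka_mapDomain_swap (lam : YoungDiagram) (i : ℕ) (d : ℕ →₀ ℕ) :
    kostka lam (d.mapDomain (Equiv.swap i (i + 1))) = kostka lam d := by
  refine (Nat.card_congr (Equiv.subtypeEquiv
    (SemistandardYoungTableau.benderKnuth_involutive i).toPerm fun T => ?_)).symm
  rw [Function.Involutive.coe_toPerm, T.content_benderKnuth i]
  exact (Finsupp.mapDomain_injective (Equiv.injective _)).eq_iff.symm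

/-- A function invariant under adjacent transpositions of the variables is invariant under
arbitrary relabellings of them. -/
theorem apply_mapDomain_eq_of_injective {β α : Type*} (F : (ℕ →₀ ℕ) → β)
    (hF : ∀ i d, F (d.mapDomain (Equiv.swap i (i + 1))) = F d) (e : α →₀ ℕ) {f g : α → ℕ}
    (hf : f.Injective) (hg : g.Injective) : F (e.mapDomain f) = F (e.mapDomain g) := by
  classical
  have hswap : ∀ k i d, F (d.mapDomain (Equiv.swap i (i + k))) = F d := by
    intro k
    induction k with
    | zero => intro i d; simp
    | succ k ih =>
      intro i d
      rcases Nat.eq_zero_or_pos k with rfl | hk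
      · exact hF i d
      have : Equiv.swap i (i + (k + 1)) =
          Equiv.swap (i + k) (i + k + 1) * Equiv.swap i (i + k) *
            Equiv.swap (i + k) (i + k + 1) := by
        rw [Equiv.swap_mul_swap_mul_swap (by omega) (by omega)]
        exact Equiv.swap_comm _ _
      rw [this, Equiv.Perm.coe_mul, Equiv.Perm.coe_mul, Finsupp.mapDomain_comp,
        Finsupp.mapDomain_comp, hF, ih, hF]
  have hswap' : ∀ i j d, F (d.mapDomain (Equiv.swap i j)) = F d := by
    intro i j d
    rcases le_total i j with h | h
    · obtain ⟨k, rfl⟩ := Nat.exists_eq_add_of_le h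
      exact hswap k i d
    · obtain ⟨k, rfl⟩ := Nat.exists_eq_add_of_le h
      rw [Equiv.swap_comm]
      exact hswap k j d
  -- Each transposition makes `f` agree with `g` at one more point of the support.
  induction hn : (e.support.filter fun x => f x ≠ g x).card using Nat.strong_induction_on
    generalizing f with
  | _ n ih =>
    by_cases hall : ∀ x ∈ e.support, f x = g x
    · rw [Finsupp.mapDomain_congr hall]
    push Not at hall
    obtain ⟨x, hx, hne⟩ := hall
    have hf' : ((Equiv.swap (f x) (g x)) ∘ f).Injective := (Equiv.injective _).comp hf
    rw [← ih _ ?_ hf' rfl, Finsupp.mapDomain_comp, hswap']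
    rw [← hn]
    refine Finset.card_lt_card (Finset.ssubset_iff_of_subset ?_ |>.2 ⟨x, ?_, ?_⟩)
    · intro y hy
      rw [Finset.mem_filter] at hy ⊢
      refine ⟨hy.1, fun hfg => hy.2 ?_⟩
      have hyx : y ≠ x := fun h => hne (h ▸ hfg)
      rw [Function.comp_apply, Equiv.swap_apply_of_ne_of_ne (hf.ne hyx)
        (hfg ▸ hg.ne hyx), hfg]
    · exact Finset.mem_filter.2 ⟨hx, hne⟩
    · simp

theorem kostka_mapDomain_eq (lam : YoungDiagram) {α : Type*} (e : α →₀ ℕ) {f g : α → ℕ}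
    (hf : f.Injective) (hg : g.Injective) :
    kostka lam (e.mapDomain f) = kostka lam (e.mapDomain g) :=
  apply_mapDomain_eq_of_injective _ (kostka_mapDomain_swap lam) e hf hg

theorem degree_eq_of_kostka_ne_zero {lam : YoungDiagram} {d : ℕ →₀ ℕ} (h : kostka lam d ≠ 0) :
    d.degree = lam.card := by
  obtain ⟨T, rfl⟩ := exists_content_eq_of_kostka_ne_zero h
  exact T.degree_content

namespace SemistandardYoungTableau

variable {μ : YoungDiagram} (T : SemistandardYoungTableau μ)

theorem le_apply {r c : ℕ} (h : (r, c) ∈ μ) : r ≤ T r c := by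
  induction r with
  | zero => exact Nat.zero_le _
  | succ r ih =>
    exact (ih (μ.up_left_mem (Nat.le_succ r) le_rfl h)).trans_lt
      (T.col_strict (Nat.lt_succ_self r) h)

theorem rowCount_eq_zero {r t : ℕ} (h : t ≤ r) : T.rowCount r t = 0 := by
  by_contra h0
  obtain ⟨h1, h2⟩ := T.lt_rowCount_iff.1 (Nat.pos_of_ne_zero h0)
  have := T.le_apply (YoungDiagram.mem_iff_lt_rowLen.2 h1)
  omega

theorem sum_content_eq_sum_rowCount_range (t : ℕ) :
    ∑ j ∈ Finset.range t, T.content j = ∑ r ∈ Finset.range t, T.rowCount r t := by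
  rw [sum_content_eq_sum_rowCount _ _ (le_max_left (μ.colLen 0) t)]
  symm
  refine Finset.sum_subset (Finset.range_mono (le_max_right _ _)) fun r _ hr => ?_
  exact T.rowCount_eq_zero (by simpa using hr)

theorem sum_content_le (t : ℕ) :
    ∑ j ∈ Finset.range t, T.content j ≤ ∑ r ∈ Finset.range t, μ.rowLen r := by
  rw [sum_content_eq_sum_rowCount_range]
  exact Finset.sum_le_sum fun r _ => T.rowCount_le_rowLen r t

/-- If the first `t` letters fill the first `t` rows, then no larger letter occurs there. -/
theorem apply_lt_of_sum_content_eq {t : ℕ}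
    (h : ∑ j ∈ Finset.range t, T.content j = ∑ r ∈ Finset.range t, μ.rowLen r) {r c : ℕ}
    (hr : r < t) (hc : (r, c) ∈ μ) : T r c < t := by
  rw [sum_content_eq_sum_rowCount_range] at h
  have := (Finset.sum_eq_sum_iff_of_le fun r _ => T.rowCount_le_rowLen r t).1 h r
    (Finset.mem_range.2 hr)
  rw [YoungDiagram.mem_iff_lt_rowLen, ← this] at hc
  exact (T.lt_rowCount_iff.1 hc).2

/-- The entries equal to `j` lie in different columns. -/
theorem content_le_rowLen_zero (j : ℕ) : T.content j ≤ μ.rowLen 0 := by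
  rw [content_apply, ← Finset.card_range (μ.rowLen 0)]
  refine Finset.card_le_card_of_injOn Prod.snd ?_ ?_
  · rintro ⟨r, c⟩ h
    have h1 := (Finset.mem_filter.1 h).1
    rw [YoungDiagram.mem_cells] at h1
    have h2 : (0, c) ∈ μ := μ.up_left_mem (Nat.zero_le r) le_rfl h1
    simpa using YoungDiagram.mem_iff_lt_rowLen.1 h2
  · rintro ⟨r, c⟩ h ⟨r', c'⟩ h' hcc
    obtain ⟨h1, h2⟩ := Finset.mem_filter.1 h
    obtain ⟨h1', h2'⟩ := Finset.mem_filter.1 h'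
    rw [YoungDiagram.mem_cells] at h1 h1'
    simp only at h2 h2' hcc
    subst hcc
    rcases lt_trichotomy r r' with hlt | rfl | hlt
    · have := T.col_strict hlt h1'; omega
    · rfl
    · have := T.col_strict hlt h1; omega

theorem content_highestWeight (μ : YoungDiagram) : (highestWeight μ).content = μ.parts := by
  ext j
  rw [content_apply, YoungDiagram.parts_apply, YoungDiagram.rowLen_eq_card]
  congr 1
  ext ⟨r, c⟩
  rw [Finset.mem_filter, YoungDiagram.mem_row_iff, YoungDiagram.mem_cells]
  refine and_congr_right fun h => ?_
  rw [highestWeight_apply, if_pos h]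

end SemistandardYoungTableau

theorem sum_le_of_kostka_ne_zero {lam : YoungDiagram} {d : ℕ →₀ ℕ} (h : kostka lam d ≠ 0)
    (t : ℕ) : ∑ j ∈ Finset.range t, d j ≤ ∑ j ∈ Finset.range t, lam.rowLen j := by
  obtain ⟨T, rfl⟩ := exists_content_eq_of_kostka_ne_zero h
  exact T.sum_content_le t

theorem apply_le_of_kostka_ne_zero {lam : YoungDiagram} {d : ℕ →₀ ℕ} (h : kostka lam d ≠ 0)
    (j : ℕ) : d j ≤ lam.rowLen 0 := by
  obtain ⟨T, rfl⟩ := exists_content_eq_of_kostka_ne_zero h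
  exact T.content_le_rowLen_zero j

theorem kostka_parts (lam : YoungDiagram) : kostka lam lam.parts = 1 := by
  rw [kostka, Nat.card_eq_one_iff_unique]
  refine ⟨⟨?_⟩, ⟨⟨_, SemistandardYoungTableau.content_highestWeight lam⟩⟩⟩
  have key : ∀ T : SemistandardYoungTableau lam, T.content = lam.parts →
      ∀ r c, (r, c) ∈ lam → T r c = r := by
    intro T hT r c h
    have h1 := T.le_apply h
    have h2 := T.apply_lt_of_sum_content_eq (t := r + 1) (by rw [hT]; rfl) (Nat.lt_succ_self r) h
    omega
  rintro ⟨T, hT⟩ ⟨T', hT'⟩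
  refine Subtype.ext (SemistandardYoungTableau.ext fun r c => ?_)
  by_cases h : (r, c) ∈ lam
  · rw [key T hT r c h, key T' hT' r c h]
  · rw [T.zeros h, T'.zeros h]

/-- If all partial sums of `a` are bounded by those of `b`, then `a ≤ b` lexicographically. -/
theorem toLex_le_of_sum_le {a b : ℕ → ℕ}
    (h : ∀ t, ∑ j ∈ Finset.range t, a j ≤ ∑ j ∈ Finset.range t, b j) : toLex a ≤ toLex b := by
  rw [← not_lt]
  rintro ⟨i, hlt, hi : b i < a i⟩
  have h1 := h (i + 1)
  have h2 : ∑ j ∈ Finset.range i, b j = ∑ j ∈ Finset.range i, a j :=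
    Finset.sum_congr rfl fun j hj => hlt j (Finset.mem_range.1 hj)
  rw [Finset.sum_range_succ, Finset.sum_range_succ] at h1
  omega

theorem toLex_le_of_kostka_ne_zero {lam : YoungDiagram} {d : ℕ →₀ ℕ} (h : kostka lam d ≠ 0) :
    toLex (d : ℕ → ℕ) ≤ toLex lam.rowLen :=
  toLex_le_of_sum_le (sum_le_of_kostka_ne_zero h)

/-! ### Schur expansions of symmetric power series -/

theorem toLex_rowLen_injective :
    Function.Injective fun κ : YoungDiagram => toLex κ.rowLen := fun _ _ h =>
  YoungDiagram.ext_rowLen fun i => congrFun (toLex.injective h) i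

theorem coeff_sum_smul_schur (a : YoungDiagram →₀ ℤ) (d : ℕ →₀ ℕ) :
    MvPowerSeries.coeff d (a.sum fun κ c => c • schur ℤ κ) =
      a.sum fun κ c => c * (kostka κ d : ℤ) := by
  rw [Finsupp.sum, Finsupp.sum, map_sum]
  refine Finset.sum_congr rfl fun κ _ => ?_
  rw [map_zsmul, coeff_schur, smul_eq_mul]

/-- By triangularity of the Kostka numbers, the coefficient of the lexicographically largest
Schur function of an expansion is the coefficient of the corresponding monomial. -/
theorem coeff_parts_sum_smul_schur (a : YoungDiagram →₀ ℤ) (ν : YoungDiagram)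
    (h : ∀ κ, a κ ≠ 0 → toLex κ.rowLen ≤ toLex ν.rowLen) :
    MvPowerSeries.coeff ν.parts (a.sum fun κ c => c • schur ℤ κ) = a ν := by
  rw [coeff_sum_smul_schur, Finsupp.sum, Finset.sum_eq_single ν]
  · rw [kostka_parts, Nat.cast_one, mul_one]
  · intro κ hκ hne
    have : kostka κ ν.parts = 0 := by
      by_contra h0
      exact hne (toLex_rowLen_injective
        (le_antisymm (h κ (Finsupp.mem_support_iff.1 hκ)) (toLex_le_of_kostka_ne_zero h0)))
    rw [this, Nat.cast_zero, mul_zero]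
  · intro hν
    rw [Finsupp.notMem_support_iff.1 hν, zero_mul]

/-- Every Schur function occurring in an expansion is lexicographically at most some
partition `ν` for which `x ^ ν` occurs. -/
theorem exists_coeff_parts_ne_zero (a : YoungDiagram →₀ ℤ) {κ : YoungDiagram} (hκ : a κ ≠ 0) :
    ∃ ν : YoungDiagram, toLex κ.rowLen ≤ toLex ν.rowLen ∧
      MvPowerSeries.coeff ν.parts (a.sum fun κ c => c • schur ℤ κ) ≠ 0 := by
  obtain ⟨ν, hν, hmax⟩ := Finset.exists_max_image a.support (fun κ => toLex κ.rowLen)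
    ⟨κ, Finsupp.mem_support_iff.2 hκ⟩
  refine ⟨ν, hmax κ (Finsupp.mem_support_iff.2 hκ), ?_⟩
  rw [coeff_parts_sum_smul_schur a ν fun κ h => hmax κ (Finsupp.mem_support_iff.2 h)]
  exact Finsupp.mem_support_iff.1 hν

theorem IsSchurExpansion.unique {f : MvPowerSeries ℕ ℤ} {a b : YoungDiagram →₀ ℤ}
    (ha : IsSchurExpansion f a) (hb : IsSchurExpansion f b) : a = b := by
  rw [← sub_eq_zero]
  by_contra hne
  obtain ⟨κ, hκ⟩ := Finsupp.ne_iff.1 hne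
  obtain ⟨ν, -, hν⟩ := exists_coeff_parts_ne_zero (a - b) hκ
  rw [Finsupp.sum_sub_index fun _ _ _ => sub_smul _ _ _, ← ha, ← hb, sub_self, map_zero] at hν
  exact hν rfl

/-- The sum `∑ i * d i` strictly decreases when an ascent `d i < d (i + 1)` is swapped, so every
exponent vector can be sorted. Hence a symmetric power series is determined by its
coefficients at partitions. -/
theorem coeff_eq_zero_of_forall_parts {f : MvPowerSeries ℕ ℤ}
    (hsymm : ∀ i d, MvPowerSeries.coeff (d.mapDomain (Equiv.swap i (i + 1))) f =
      MvPowerSeries.coeff d f)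
    (hpart : ∀ κ : YoungDiagram, MvPowerSeries.coeff κ.parts f = 0) : f = 0 := by
  ext d
  rw [map_zero]
  induction hn : d.sum (fun i k => i * k) using Nat.strong_induction_on generalizing d with
  | _ n ih =>
    by_cases hd : ∀ i, d (i + 1) ≤ d i
    · obtain ⟨κ, rfl⟩ := YoungDiagram.exists_parts_eq d hd
      exact hpart κ
    push Not at hd
    obtain ⟨i, hi⟩ := hd
    rw [← hsymm i]
    refine ih _ ?_ _ rfl
    rw [← hn, Finsupp.sum_mapDomain_index_inj (Equiv.injective _)]
    have hi0 : i + 1 ∈ d.support := Finsupp.mem_support_iff.2 (by omega)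
    -- The supports are enlarged so that both positions `i` and `i + 1` are covered.
    rw [Finsupp.sum_of_support_subset d (s := insert i d.support) (Finset.subset_insert _ _) _
      (by simp), Finsupp.sum_of_support_subset d (s := insert i d.support)
      (Finset.subset_insert _ _) _ (by simp)]
    have h1 : i ∈ insert i d.support := Finset.mem_insert_self _ _
    have h2 : i + 1 ∈ (insert i d.support).erase i :=
      Finset.mem_erase.2 ⟨by omega, Finset.mem_insert_of_mem hi0⟩
    rw [← Finset.add_sum_erase _ _ h1, ← Finset.add_sum_erase _ _ h2,
      ← Finset.add_sum_erase (insert i d.support) (fun j => j * d j) h1,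
      ← Finset.add_sum_erase _ (fun j => j * d j) h2]
    have h3 : ∑ j ∈ ((insert i d.support).erase i).erase (i + 1), Equiv.swap i (i + 1) j * d j =
        ∑ j ∈ ((insert i d.support).erase i).erase (i + 1), j * d j := by
      refine Finset.sum_congr rfl fun j hj => ?_
      rw [Finset.mem_erase, Finset.mem_erase] at hj
      rw [Equiv.swap_apply_of_ne_of_ne hj.2.1 hj.1]
    rw [h3, Equiv.swap_apply_left, Equiv.swap_apply_right]
    have : (i + 1) * d i + i * d (i + 1) < i * d i + (i + 1) * d (i + 1) := by
      rw [add_mul, add_mul]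
      omega
    omega

/-- A homogeneous symmetric power series is a finite linear combination of Schur functions. -/
theorem exists_isSchurExpansion (m : ℕ) (f : MvPowerSeries ℕ ℤ)
    (hsymm : ∀ i d, MvPowerSeries.coeff (d.mapDomain (Equiv.swap i (i + 1))) f =
      MvPowerSeries.coeff d f)
    (hhom : ∀ d, MvPowerSeries.coeff d f ≠ 0 → d.degree = m) :
    ∃ a : YoungDiagram →₀ ℤ, IsSchurExpansion f a := by
  classical
  set P : Finset YoungDiagram := (YoungDiagram.finite_card_eq m).toFinset with hP
  have hmemP : ∀ κ, κ ∈ P ↔ κ.card = m := fun κ => by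
    rw [hP, Set.Finite.mem_toFinset]
    rfl
  -- Leading terms are removed one by one; `s` is a lexicographic initial segment of the
  -- partitions of `m`, containing all those that occur in `f`.
  have key : ∀ s : Finset YoungDiagram, s ⊆ P →
      (∀ κ ∈ P, κ ∉ s → ∀ x ∈ s, toLex x.rowLen < toLex κ.rowLen) →
      ∀ f : MvPowerSeries ℕ ℤ,
      (∀ i d, MvPowerSeries.coeff (d.mapDomain (Equiv.swap i (i + 1))) f =
        MvPowerSeries.coeff d f) →
      (∀ κ : YoungDiagram, κ ∉ s → MvPowerSeries.coeff κ.parts f = 0) →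
      ∃ a : YoungDiagram →₀ ℤ, IsSchurExpansion f a := by
    intro s
    induction s using Finset.induction_on_max_value (fun κ : YoungDiagram => toLex κ.rowLen) with
    | empty =>
      intro _ _ f hs hf
      refine ⟨0, ?_⟩
      rw [IsSchurExpansion, Finsupp.sum_zero_index]
      exact coeff_eq_zero_of_forall_parts hs fun κ => hf κ (Finset.notMem_empty κ)
    | insert ν s hν hmax ih =>
      intro hsub hinit f hs hf
      have hlt : ∀ x ∈ s, toLex x.rowLen < toLex ν.rowLen := fun x hx =>
        lt_of_le_of_ne (hmax x hx) fun h => hν (toLex_rowLen_injective h ▸ hx)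
      set c := MvPowerSeries.coeff ν.parts f with hc
      obtain ⟨a, ha⟩ := ih (fun x hx => hsub (Finset.mem_insert_of_mem hx)) (by
          intro κ hκ hκs x hx
          by_cases h : κ = ν
          · exact h ▸ hlt x hx
          · exact hinit κ hκ (by simp [h, hκs]) x (Finset.mem_insert_of_mem hx))
        (f - c • schur ℤ ν) (by
          intro i d
          rw [map_sub, map_sub, map_zsmul, map_zsmul, coeff_schur, coeff_schur, hs,
            kostka_mapDomain_swap]) (by
          intro κ hκs
          rw [map_sub, map_zsmul, coeff_schur]
          by_cases h : κ = ν
          · rw [h, kostka_parts, Nat.cast_one, smul_eq_mul, mul_one, ← hc, sub_self]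
          · have hκ : κ ∉ insert ν s := by simp [h, hκs]
            have : kostka ν κ.parts = 0 := by
              by_contra h0
              have hcard := degree_eq_of_kostka_ne_zero h0
              rw [YoungDiagram.degree_parts,
                (hmemP ν).1 (hsub (Finset.mem_insert_self _ _))] at hcard
              exact absurd (hinit κ ((hmemP κ).2 hcard) hκ ν (Finset.mem_insert_self _ _))
                (not_lt.2 (toLex_le_of_kostka_ne_zero h0))
            rw [hf κ hκ, this, Nat.cast_zero, smul_zero, sub_zero])
      refine ⟨a + Finsupp.single ν c, ?_⟩
      rw [IsSchurExpansion, Finsupp.sum_add_index' (h := fun κ (c : ℤ) => c • schur ℤ κ)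
        (fun _ => zero_smul _ _) (fun _ _ _ => add_smul _ _ _), Finsupp.sum_single_index
        (h := fun κ (c : ℤ) => c • schur ℤ κ) (zero_smul _ _), ← ha,
        sub_add_cancel]
  refine key P (Finset.Subset.refl P) (fun κ h1 h2 => absurd h1 h2) f hsymm fun κ hκ => ?_
  by_contra h
  exact hκ ((hmemP κ).2 (by rw [← YoungDiagram.degree_parts, hhom _ h]))

/-! ### Coefficients of the plethysm -/

/-- The exponent of the monomial `∏ y_p ^ e_p`, where `y_p = x ^ p.1` runs over the terms
of `g`. -/
noncomputable def totalExponent {g : MvPowerSeries ℕ ℕ} (e : MonomialIndex g →₀ ℕ) : ℕ →₀ ℕ :=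
  ∑ p ∈ e.support, e p • p.1

theorem totalExponent_apply {g : MvPowerSeries ℕ ℕ} (e : MonomialIndex g →₀ ℕ) (x : ℕ) :
    totalExponent e x = ∑ p ∈ e.support, e p * p.1 x := by
  simp [totalExponent, Finsupp.finsetSum_apply]

theorem totalExponent_eq_sum {g : MvPowerSeries ℕ ℕ} (e : MonomialIndex g →₀ ℕ) :
    totalExponent e = e.sum fun p k => k • p.1 := rfl

/-- The injection chosen in the definition of `monomialSeq`. -/
noncomputable def monomialPosition (g : MvPowerSeries ℕ ℕ) : MonomialIndex g → ℕ :=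
  (Countable.exists_injective_nat (MonomialIndex g)).choose

theorem monomialPosition_injective (g : MvPowerSeries ℕ ℕ) :
    Function.Injective (monomialPosition g) :=
  (Countable.exists_injective_nat (MonomialIndex g)).choose_spec

theorem monomialSeq_monomialPosition {g : MvPowerSeries ℕ ℕ} (p : MonomialIndex g) :
    monomialSeq g (monomialPosition g p) = MvPowerSeries.monomial p.1 1 :=
  (monomialPosition_injective g).extend_apply _ _ p

theorem monomialSeq_eq_zero {g : MvPowerSeries ℕ ℕ} {s : ℕ}
    (hs : s ∉ Set.range (monomialPosition g)) : monomialSeq g s = 0 :=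
  Function.extend_apply' _ _ s hs

theorem hasSubst_monomialSeq {g : MvPowerSeries ℕ ℕ} (hg : MvPowerSeries.coeff 0 g = 0) :
    MvPowerSeries.HasSubst (monomialSeq g) where
  const_coeff s := by
    by_cases hs : s ∈ Set.range (monomialPosition g)
    · obtain ⟨p, rfl⟩ := hs
      have hp : p.1 ≠ 0 := by
        intro h
        have := p.2.pos
        rw [h, hg] at this
        exact lt_irrefl _ this
      rw [monomialSeq_monomialPosition, ← MvPowerSeries.coeff_zero_eq_constantCoeff_apply,
        MvPowerSeries.coeff_monomial_ne hp.symm]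
      exact IsNilpotent.zero
    · rw [monomialSeq_eq_zero hs, map_zero]
      exact IsNilpotent.zero
  coeff_zero d := by
    -- Only the finitely many terms of `g` with exponent `d` contribute.
    refine (Set.finite_range fun i : Fin (MvPowerSeries.coeff d g) =>
      monomialPosition g ⟨d, i⟩).subset fun s hs => ?_
    by_cases hr : s ∈ Set.range (monomialPosition g)
    · obtain ⟨⟨d', i⟩, rfl⟩ := hr
      have hd : d' = d := by
        by_contra hne
        refine hs ?_
        rw [monomialSeq_monomialPosition, MvPowerSeries.coeff_monomial_ne (Ne.symm hne)]
      subst hd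
      exact ⟨i, rfl⟩
    · exact absurd (by rw [monomialSeq_eq_zero hr, map_zero]) hs

theorem prod_monomialSeq_mapDomain {g : MvPowerSeries ℕ ℕ} (e : MonomialIndex g →₀ ℕ) :
    ((e.mapDomain (monomialPosition g)).prod fun s k => monomialSeq g s ^ k) =
      MvPowerSeries.monomial (totalExponent e) 1 := by
  rw [Finsupp.prod_mapDomain_index_inj (monomialPosition_injective g), totalExponent,
    Finsupp.prod]
  simp_rw [monomialSeq_monomialPosition, MvPowerSeries.monomial_pow, one_pow]
  rw [MvPowerSeries.prod_monomial, Finset.prod_const_one]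

theorem kostka_ne_zero_of_monomialIndex {μ : YoungDiagram} (p : MonomialIndex (schur ℕ μ)) :
    kostka μ p.1 ≠ 0 := by
  have : 0 < kostka μ p.1 := p.2.pos
  exact this.ne'

theorem kostka_zero_of_ne_bot {μ : YoungDiagram} (hμ : μ ≠ ⊥) : kostka μ 0 = 0 := by
  by_contra h
  have h1 := degree_eq_of_kostka_ne_zero h
  rw [map_zero] at h1
  exact hμ (YoungDiagram.ext (Finset.card_eq_zero.1 h1.symm))

/-- The plethysm is the sum of the Kostka numbers of `lam` over all monomials in the monomials
of `s_μ`, for any enumeration `ι` of the latter. -/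
theorem coeff_plethysm_schur {lam μ : YoungDiagram} (hμ : μ ≠ ⊥)
    {ι : MonomialIndex (schur ℕ μ) → ℕ} (hι : ι.Injective) (D : ℕ →₀ ℕ) :
    MvPowerSeries.coeff D (plethysm (schur ℤ lam) (schur ℕ μ)) =
      ∑ᶠ e : MonomialIndex (schur ℕ μ) →₀ ℕ,
        if totalExponent e = D then (kostka lam (e.mapDomain ι) : ℤ) else 0 := by
  classical
  set g := schur ℕ μ with hg
  have hg0 : MvPowerSeries.coeff 0 g = 0 := by
    rw [hg, coeff_schur, kostka_zero_of_ne_bot hμ, Nat.cast_zero]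
  have hpos := monomialPosition_injective g
  rw [plethysm, MvPowerSeries.coeff_subst (hasSubst_monomialSeq hg0)]
  have hrange : ∀ d : ℕ →₀ ℕ, d ∉ Set.range (Finsupp.mapDomain (M := ℕ) (monomialPosition g)) →
      (d.prod fun s k => monomialSeq g s ^ k) = 0 := by
    intro d hd
    have : ∃ s ∈ d.support, s ∉ Set.range (monomialPosition g) := by
      by_contra! h
      exact hd ⟨_, Finsupp.mapDomain_comapDomain _ hpos d fun s hs => h s hs⟩
    obtain ⟨s, hs, hsr⟩ := this
    refine Finset.prod_eq_zero hs ?_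
    simp only [monomialSeq_eq_zero hsr]
    exact zero_pow (Finsupp.mem_support_iff.1 hs)
  calc _ = ∑ᶠ d ∈ Set.range (Finsupp.mapDomain (M := ℕ) (monomialPosition g)),
        MvPowerSeries.coeff d (schur ℤ lam) •
          MvPowerSeries.coeff D (d.prod fun s k => monomialSeq g s ^ k) := by
        refine finsum_congr fun d => ?_
        by_cases hd : d ∈ Set.range (Finsupp.mapDomain (M := ℕ) (monomialPosition g))
        · rw [finsum_eq_if, if_pos hd]
        · rw [finsum_eq_if, if_neg hd, hrange d hd, map_zero, smul_zero]
    _ = _ := by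
        rw [finsum_mem_range (Finsupp.mapDomain_injective hpos)]
        refine finsum_congr fun e => ?_
        rw [prod_monomialSeq_mapDomain, coeff_schur, kostka_mapDomain_eq lam e hpos hι,
          MvPowerSeries.coeff_monomial, smul_eq_mul]
        by_cases h : totalExponent e = D
        · rw [if_pos h, if_pos h.symm, mul_one]
        · rw [if_neg h, if_neg (Ne.symm h), mul_zero]

theorem exists_of_coeff_plethysm_ne_zero {lam μ : YoungDiagram} (hμ : μ ≠ ⊥)
    {ι : MonomialIndex (schur ℕ μ) → ℕ} (hι : ι.Injective) {D : ℕ →₀ ℕ}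
    (h : MvPowerSeries.coeff D (plethysm (schur ℤ lam) (schur ℕ μ)) ≠ 0) :
    ∃ e : MonomialIndex (schur ℕ μ) →₀ ℕ,
      totalExponent e = D ∧ kostka lam (e.mapDomain ι) ≠ 0 := by
  by_contra! hzero
  refine h ?_
  rw [coeff_plethysm_schur hμ hι]
  refine finsum_eq_zero_of_forall_eq_zero fun e => ?_
  by_cases he : totalExponent e = D
  · rw [hzero e he, Nat.cast_zero, ite_self]
  · rw [if_neg he]

theorem degree_of_kostka_mapDomain_ne_zero {lam : YoungDiagram} {α : Type*} {ι : α → ℕ}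
    {e : α →₀ ℕ} (h : kostka lam (e.mapDomain ι) ≠ 0) : e.degree = lam.card := by
  rw [← degree_eq_of_kostka_ne_zero h, Finsupp.degree_mapDomain]

theorem degree_of_coeff_plethysm_ne_zero {lam μ : YoungDiagram} (hμ : μ ≠ ⊥) {D : ℕ →₀ ℕ}
    (h : MvPowerSeries.coeff D (plethysm (schur ℤ lam) (schur ℕ μ)) ≠ 0) :
    D.degree = lam.card * μ.card := by
  obtain ⟨e, rfl, he⟩ :=
    exists_of_coeff_plethysm_ne_zero hμ (monomialPosition_injective _) h
  rw [totalExponent, map_sum, ← degree_of_kostka_mapDomain_ne_zero he, Finsupp.degree_apply,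
    Finset.sum_mul]
  refine Finset.sum_congr rfl fun p _ => ?_
  rw [map_nsmul, degree_eq_of_kostka_ne_zero (kostka_ne_zero_of_monomialIndex p), smul_eq_mul]

/-- The permutation of the terms of a symmetric power series induced by an adjacent transposition
of the variables. -/
noncomputable def monomialIndexSwap (μ : YoungDiagram) (i : ℕ) :
    MonomialIndex (schur ℕ μ) ≃ MonomialIndex (schur ℕ μ) :=
  Equiv.sigmaCongr (Finsupp.domCongr (Equiv.swap i (i + 1))).toEquiv fun d =>
    finCongr (by
      rw [coeff_schur, coeff_schur, AddEquiv.toEquiv_eq_coe, AddEquiv.coe_toEquiv,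
        Finsupp.domCongr_apply, Finsupp.equivMapDomain_eq_mapDomain, kostka_mapDomain_swap])

theorem monomialIndexSwap_fst {μ : YoungDiagram} (i : ℕ) (p : MonomialIndex (schur ℕ μ)) :
    (monomialIndexSwap μ i p).1 = p.1.mapDomain (Equiv.swap i (i + 1)) :=
  Finsupp.equivMapDomain_eq_mapDomain _ _

theorem totalExponent_mapDomain_monomialIndexSwap {μ : YoungDiagram} (i : ℕ)
    (e : MonomialIndex (schur ℕ μ) →₀ ℕ) :
    totalExponent (e.mapDomain (monomialIndexSwap μ i)) =
      (totalExponent e).mapDomain (Equiv.swap i (i + 1)) := by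
  rw [totalExponent_eq_sum, Finsupp.sum_mapDomain_index_inj (Equiv.injective _), totalExponent,
    Finsupp.mapDomain_finsetSum, Finsupp.sum]
  refine Finset.sum_congr rfl fun p _ => ?_
  rw [monomialIndexSwap_fst, Finsupp.mapDomain_smul]

/-- The plethysm is symmetric. -/
theorem coeff_mapDomain_swap_plethysm {lam μ : YoungDiagram} (hμ : μ ≠ ⊥) (i : ℕ) (D : ℕ →₀ ℕ) :
    MvPowerSeries.coeff (D.mapDomain (Equiv.swap i (i + 1)))
        (plethysm (schur ℤ lam) (schur ℕ μ)) =
      MvPowerSeries.coeff D (plethysm (schur ℤ lam) (schur ℕ μ)) := by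
  have hι := monomialPosition_injective (schur ℕ μ)
  rw [coeff_plethysm_schur hμ hι,
    coeff_plethysm_schur hμ (hι.comp (monomialIndexSwap μ i).injective),
    ← finsum_comp_equiv (Finsupp.domCongr (monomialIndexSwap μ i)).toEquiv]
  refine finsum_congr fun e => ?_
  rw [AddEquiv.toEquiv_eq_coe, AddEquiv.coe_toEquiv,
    Finsupp.domCongr_apply, Finsupp.equivMapDomain_eq_mapDomain,
    totalExponent_mapDomain_monomialIndexSwap, ← Finsupp.mapDomain_comp]
  simp only [(Finsupp.mapDomain_injective (Equiv.injective (Equiv.swap i (i + 1)))).eq_iff]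

/-! ### The lexicographically largest tableaux -/

/-- The (zero-based) index of the last nonempty row of a nonempty Young diagram
(`0` for the empty one). -/
def YoungDiagram.lastRow (μ : YoungDiagram) : ℕ := μ.colLen 0 - 1

/-- The content of the tableau of shape `μ` all of whose rows are constant, row `r` consisting of
entries `r`, except that the very last entry is raised by `j`. -/
noncomputable def raisedContent (μ : YoungDiagram) (j : ℕ) : ℕ →₀ ℕ :=
  μ.parts - Finsupp.single μ.lastRow 1 + Finsupp.single (μ.lastRow + j) 1

theorem YoungDiagram.colLen_zero_eq {μ : YoungDiagram} (hμ : μ ≠ ⊥) :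
    μ.colLen 0 = μ.lastRow + 1 := by
  have : μ.colLen 0 ≠ 0 := by
    intro h
    refine hμ (YoungDiagram.ext_rowLen fun i => ?_)
    rw [rowLen_eq_zero (by omega)]
    by_contra h0
    have := mem_iff_lt_rowLen.2 (Nat.pos_of_ne_zero (Ne.symm h0))
    exact notMem_bot _ this
  rw [lastRow]
  omega

theorem YoungDiagram.rowLen_lastRow_pos {μ : YoungDiagram} (hμ : μ ≠ ⊥) :
    0 < μ.rowLen μ.lastRow :=
  rowLen_pos_iff.2 (by rw [colLen_zero_eq hμ]; omega)

theorem YoungDiagram.rowLen_eq_zero_of_lastRow_lt {μ : YoungDiagram} {x : ℕ}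
    (h : μ.lastRow < x) : μ.rowLen x = 0 :=
  rowLen_eq_zero (by rw [lastRow] at h; omega)

theorem raisedContent_of_lt {μ : YoungDiagram} (j : ℕ) {x : ℕ} (h : x < μ.lastRow) :
    raisedContent μ j x = μ.rowLen x := by
  simp only [raisedContent, Finsupp.add_apply, Finsupp.tsub_apply, YoungDiagram.parts_apply,
    Finsupp.single_apply]
  rw [if_neg (by omega), if_neg (by omega)]
  omega

theorem raisedContent_lastRow (μ : YoungDiagram) (j : ℕ) :
    raisedContent μ j μ.lastRow = μ.rowLen μ.lastRow - 1 + if j = 0 then 1 else 0 := by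
  simp [raisedContent, Finsupp.single_apply]

theorem raisedContent_lastRow_add (μ : YoungDiagram) (j : ℕ) {i : ℕ} (hi : i ≠ 0) :
    raisedContent μ j (μ.lastRow + i) = if j = i then 1 else 0 := by
  simp only [raisedContent, Finsupp.add_apply, Finsupp.tsub_apply, YoungDiagram.parts_apply,
    Finsupp.single_apply]
  rw [YoungDiagram.rowLen_eq_zero_of_lastRow_lt (by omega)]
  simp

theorem raisedContent_add_single {μ : YoungDiagram} (hμ : μ ≠ ⊥) (j : ℕ) :
    raisedContent μ j + Finsupp.single μ.lastRow 1 =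
      μ.parts + Finsupp.single (μ.lastRow + j) 1 := by
  have : Finsupp.single μ.lastRow 1 ≤ μ.parts := by
    rw [Finsupp.single_le_iff]
    exact YoungDiagram.rowLen_lastRow_pos hμ
  rw [raisedContent, add_right_comm, tsub_add_cancel_of_le this]

theorem raisedContent_zero {μ : YoungDiagram} (hμ : μ ≠ ⊥) : raisedContent μ 0 = μ.parts :=
  add_right_cancel (raisedContent_add_single hμ 0)

theorem degree_raisedContent {μ : YoungDiagram} (hμ : μ ≠ ⊥) (j : ℕ) :
    (raisedContent μ j).degree = μ.card := by
  have h := congrArg Finsupp.degree (raisedContent_add_single hμ j)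
  rw [map_add, map_add, Finsupp.degree_single, Finsupp.degree_single,
    YoungDiagram.degree_parts] at h
  exact Nat.add_right_cancel h

theorem raisedContent_injective (μ : YoungDiagram) : Function.Injective (raisedContent μ) := by
  intro i j h
  have := Finsupp.single_left_injective one_ne_zero (add_left_cancel h)
  omega

/-- The tableau with content `raisedContent μ j`. -/
def raisedTableau (μ : YoungDiagram) (j : ℕ) : SemistandardYoungTableau μ where
  entry r c := if (r, c) ∈ μ then
    (if r = μ.lastRow ∧ c + 1 = μ.rowLen r then r + j else r) else 0
  row_weak' := by
    intro r c1 c2 h hc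
    have h1 := YoungDiagram.mem_iff_lt_rowLen.1 hc
    rw [if_pos hc, if_pos (μ.up_left_mem le_rfl h.le hc), if_neg (by omega)]
    split_ifs <;> omega
  col_strict' := by
    intro r1 r2 c h hc
    have h1 : ¬ μ.lastRow < r2 := by
      intro hlt
      have h1 := YoungDiagram.mem_iff_lt_rowLen.1 hc
      rw [YoungDiagram.rowLen_eq_zero_of_lastRow_lt hlt] at h1
      omega
    rw [if_pos hc, if_pos (μ.up_left_mem h.le le_rfl hc), if_neg (by omega)]
    split_ifs <;> omega
  zeros' h := if_neg h

theorem raisedTableau_apply {μ : YoungDiagram} (j : ℕ) {r c : ℕ} (h : (r, c) ∈ μ) :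
    raisedTableau μ j r c = if r = μ.lastRow ∧ c + 1 = μ.rowLen r then r + j else r :=
  if_pos h

theorem content_raisedTableau {μ : YoungDiagram} (hμ : μ ≠ ⊥) (j : ℕ) :
    (raisedTableau μ j).content = raisedContent μ j := by
  have hpos := YoungDiagram.rowLen_lastRow_pos hμ
  set p : ℕ × ℕ := (μ.lastRow, μ.rowLen μ.lastRow - 1) with hp
  have hmem : p ∈ μ.cells := by
    rw [YoungDiagram.mem_cells, hp, YoungDiagram.mem_iff_lt_rowLen]
    omega
  have hpj : ∀ j, raisedTableau μ j p.1 p.2 = μ.lastRow + j := fun j => by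
    rw [raisedTableau_apply j hmem, if_pos ⟨rfl, Nat.sub_add_cancel hpos⟩]
  have key : ∀ j, (raisedTableau μ j).content =
      Finsupp.single (μ.lastRow + j) 1 + ∑ c ∈ μ.cells.erase p, Finsupp.single c.1 1 := by
    intro j
    rw [SemistandardYoungTableau.content, ← Finset.add_sum_erase _ _ hmem, hpj]
    congr 1
    refine Finset.sum_congr rfl fun c hc => ?_
    rw [Finset.mem_erase] at hc
    rw [raisedTableau_apply j hc.2, if_neg]
    rintro ⟨h1, h2⟩
    refine hc.1 (Prod.ext h1 ?_)
    rw [h1] at h2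
    simp only [hp]
    omega
  have h0 : raisedTableau μ 0 = SemistandardYoungTableau.highestWeight μ := by
    ext r c
    by_cases h : (r, c) ∈ μ
    · rw [raisedTableau_apply 0 h, SemistandardYoungTableau.highestWeight_apply, if_pos h,
        add_zero, ite_self]
    · rw [SemistandardYoungTableau.zeros _ h, SemistandardYoungTableau.zeros _ h]
  have hk := key 0
  rw [h0, SemistandardYoungTableau.content_highestWeight, add_zero] at hk
  refine add_right_cancel (b := Finsupp.single μ.lastRow 1) ?_
  rw [raisedContent_add_single hμ, hk, key]
  abel

theorem eq_raisedTableau {μ : YoungDiagram} (hμ : μ ≠ ⊥) {j : ℕ}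
    {T : SemistandardYoungTableau μ} (hT : T.content = raisedContent μ j) :
    T = raisedTableau μ j := by
  have hpos := YoungDiagram.rowLen_lastRow_pos hμ
  have hsum : ∀ t ≤ μ.lastRow,
      ∑ x ∈ Finset.range t, T.content x = ∑ x ∈ Finset.range t, μ.rowLen x := by
    intro t ht
    refine Finset.sum_congr rfl fun x hx => ?_
    rw [Finset.mem_range] at hx
    rw [hT, raisedContent_of_lt j (by omega)]
  have hupper : ∀ r c, r < μ.lastRow → (r, c) ∈ μ → T r c = r := by
    intro r c hr h
    have h1 := T.le_apply h
    have h2 := T.apply_lt_of_sum_content_eq (hsum (r + 1) hr) (Nat.lt_succ_self r) h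
    omega
  have hrow : ∀ r c, (r, c) ∈ μ → r ≤ μ.lastRow := by
    intro r c h
    by_contra hr
    have h1 := YoungDiagram.mem_iff_lt_rowLen.1 h
    rw [YoungDiagram.rowLen_eq_zero_of_lastRow_lt (by omega)] at h1
    omega
  -- All but possibly one of the entries of the last row are as small as possible.
  have hcount : T.rowCount μ.lastRow (μ.lastRow + 1) =
      μ.rowLen μ.lastRow - 1 + if j = 0 then 1 else 0 := by
    have h1 := T.sum_content_eq_sum_rowCount_range (μ.lastRow + 1)
    rw [Finset.sum_range_succ, Finset.sum_range_succ, hsum _ le_rfl, hT,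
      raisedContent_lastRow] at h1
    have h2 : ∑ r ∈ Finset.range μ.lastRow, T.rowCount r (μ.lastRow + 1) =
        ∑ r ∈ Finset.range μ.lastRow, μ.rowLen r := by
      refine Finset.sum_congr rfl fun r hr => le_antisymm (T.rowCount_le_rowLen _ _) ?_
      refine le_of_forall_lt fun c hc => ?_
      rw [Finset.mem_range] at hr
      rw [T.lt_rowCount_iff, hupper r c hr (YoungDiagram.mem_iff_lt_rowLen.2 hc)]
      exact ⟨hc, by omega⟩
    omega
  have hlow : ∀ c, (μ.lastRow, c) ∈ μ → (c + 1 < μ.rowLen μ.lastRow ∨ j = 0) →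
      T μ.lastRow c = μ.lastRow := by
    intro c h hc
    have h1 := T.le_apply h
    have h3 := YoungDiagram.mem_iff_lt_rowLen.1 h
    have h2 := (T.lt_rowCount_iff (r := μ.lastRow) (t := μ.lastRow + 1) (c := c)).1 (by
      rw [hcount]
      split_ifs <;> omega)
    omega
  have hlast : ∀ c, (μ.lastRow, c) ∈ μ → c + 1 = μ.rowLen μ.lastRow →
      T μ.lastRow c = μ.lastRow + j := by
    intro c h hc
    rcases Nat.eq_zero_or_pos j with hj | hj
    · rw [hlow c h (Or.inr hj), hj, add_zero]
    -- The letter `lastRow + j` occurs somewhere, and there is no other place for it.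
    have hne : T.content (μ.lastRow + j) ≠ 0 := by
      rw [hT, raisedContent_lastRow_add μ j hj.ne', if_pos rfl]
      exact one_ne_zero
    rw [T.content_apply, Finset.card_ne_zero] at hne
    obtain ⟨⟨r, c'⟩, hrc⟩ := hne
    rw [Finset.mem_filter, YoungDiagram.mem_cells] at hrc
    obtain ⟨h1, h2⟩ := hrc
    simp only at h2
    have hr : r = μ.lastRow := by
      by_contra hne
      have h3 := hrow r c' h1
      rw [hupper r c' (by omega) h1] at h2
      omega
    subst hr
    have h3 := YoungDiagram.mem_iff_lt_rowLen.1 h1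
    have hc' : c' = c := by
      by_contra hne
      rw [hlow c' h1 (Or.inl (by omega))] at h2
      omega
    rw [← hc', h2]
  ext r c
  by_cases h : (r, c) ∈ μ
  · have h1 := YoungDiagram.mem_iff_lt_rowLen.1 h
    rw [raisedTableau_apply j h]
    by_cases hr : r = μ.lastRow
    · rw [hr] at h h1 ⊢
      by_cases hc : c + 1 = μ.rowLen μ.lastRow
      · rw [if_pos ⟨rfl, hc⟩, hlast c h hc]
      · rw [if_neg fun h' => hc h'.2, hlow c h (Or.inl (by omega))]
    · rw [if_neg fun h' => hr h'.1, hupper r c (lt_of_le_of_ne (hrow r c h) hr) h]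
  · rw [SemistandardYoungTableau.zeros _ h, SemistandardYoungTableau.zeros _ h]

theorem kostka_raisedContent {μ : YoungDiagram} (hμ : μ ≠ ⊥) (j : ℕ) :
    kostka μ (raisedContent μ j) = 1 := by
  rw [kostka, Nat.card_eq_one_iff_unique]
  refine ⟨⟨fun T T' => Subtype.ext ?_⟩, ⟨⟨_, content_raisedTableau hμ j⟩⟩⟩
  rw [eq_raisedTableau hμ T.2, eq_raisedTableau hμ T'.2]

theorem Finsupp.eq_of_le_of_degree_eq {α : Type*} {c d : α →₀ ℕ} (hle : c ≤ d)
    (hdeg : c.degree = d.degree) : c = d := by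
  have h : (d - c).degree = 0 := by
    have := congrArg Finsupp.degree (add_tsub_cancel_of_le hle)
    rw [map_add] at this
    omega
  rw [Finsupp.degree_eq_zero_iff] at h
  rw [← add_tsub_cancel_of_le hle, h, add_zero]

/-- An exponent vector that agrees with `μ` before the last part, is at most one smaller
there, and has the degree of `μ`, is the content of one of the tableaux `raisedTableau μ j`. -/
theorem exists_eq_raisedContent {μ : YoungDiagram} (hμ : μ ≠ ⊥) {d : ℕ →₀ ℕ}
    (hdeg : d.degree = μ.card) (hlt : ∀ x < μ.lastRow, d x = μ.rowLen x)
    (hlast : μ.rowLen μ.lastRow ≤ d μ.lastRow + 1) : ∃ j, d = raisedContent μ j := by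
  by_cases hle : μ.rowLen μ.lastRow ≤ d μ.lastRow
  · refine ⟨0, ?_⟩
    rw [raisedContent_zero hμ]
    refine (Finsupp.eq_of_le_of_degree_eq (fun x => ?_) ?_).symm
    · rw [YoungDiagram.parts_apply]
      rcases lt_trichotomy x μ.lastRow with h | h | h
      · exact (hlt x h).ge
      · rw [h]; exact hle
      · rw [YoungDiagram.rowLen_eq_zero_of_lastRow_lt h]; exact Nat.zero_le _
    · rw [YoungDiagram.degree_parts, hdeg]
  · have hex : ∃ j, j ≠ 0 ∧ d (μ.lastRow + j) ≠ 0 := by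
      by_contra! hzero
      -- Otherwise the degree of `d` is one less than that of `μ`.
      have hled : d ≤ μ.parts := fun x => by
        rw [YoungDiagram.parts_apply]
        rcases lt_trichotomy x μ.lastRow with h | h | h
        · exact (hlt x h).le
        · rw [h]; omega
        · obtain ⟨j, rfl⟩ := Nat.exists_eq_add_of_lt h
          rw [add_assoc, hzero (j + 1) (by omega)]
          exact Nat.zero_le _
      have := Finsupp.eq_of_le_of_degree_eq hled (by rw [hdeg, YoungDiagram.degree_parts])
      rw [this] at hle
      exact hle le_rfl
    obtain ⟨j, hj, hdj⟩ := hex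
    refine ⟨j, (Finsupp.eq_of_le_of_degree_eq (fun x => ?_) ?_).symm⟩
    · rcases lt_trichotomy x μ.lastRow with h | h | h
      · rw [raisedContent_of_lt j h, hlt x h]
      · rw [h, raisedContent_lastRow, if_neg hj]; omega
      · obtain ⟨i, rfl⟩ := Nat.exists_eq_add_of_lt h
        rw [add_assoc, raisedContent_lastRow_add μ j (by omega)]
        split_ifs with hji
        · rw [← hji]; omega
        · exact Nat.zero_le _
    · rw [degree_raisedContent hμ, hdeg]

/-! ### The leading monomial of the plethysm -/

theorem leadingPart_of_lt {lam μ : YoungDiagram} (hμ : μ ≠ ⊥) {x : ℕ} (h : x < μ.lastRow) :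
    leadingPart lam μ x = lam.card * μ.rowLen x := by
  rw [leadingPart, μ.colLen_zero_eq hμ, if_pos (by omega)]

theorem leadingPart_lastRow {lam μ : YoungDiagram} (hμ : μ ≠ ⊥) :
    leadingPart lam μ μ.lastRow =
      lam.card * (μ.rowLen μ.lastRow - 1) + lam.rowLen 0 := by
  rw [leadingPart, μ.colLen_zero_eq hμ, if_neg (by omega), if_pos rfl, Nat.mul_sub, mul_one]

theorem leadingPart_lastRow_add {lam μ : YoungDiagram} (hμ : μ ≠ ⊥) {j : ℕ} (hj : j ≠ 0) :
    leadingPart lam μ (μ.lastRow + j) = lam.rowLen j := by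
  rw [leadingPart, μ.colLen_zero_eq hμ, if_neg (by omega), if_neg (by omega)]
  congr 1
  omega

/-- The position of the unique tableau with content `raisedContent μ j` among the terms
of `s_μ`. -/
noncomputable def raisedIndex {μ : YoungDiagram} (hμ : μ ≠ ⊥) (j : ℕ) :
    MonomialIndex (schur ℕ μ) :=
  ⟨raisedContent μ j, ⟨0, by rw [coeff_schur, kostka_raisedContent hμ]; exact Nat.one_pos⟩⟩

theorem raisedIndex_injective {μ : YoungDiagram} (hμ : μ ≠ ⊥) :
    Function.Injective (raisedIndex hμ) := fun _ _ h =>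
  raisedContent_injective μ (congrArg Sigma.fst h)

theorem eq_raisedIndex {μ : YoungDiagram} (hμ : μ ≠ ⊥) {p : MonomialIndex (schur ℕ μ)} {j : ℕ}
    (h : p.1 = raisedContent μ j) : p = raisedIndex hμ j := by
  obtain ⟨d, i⟩ := p
  subst h
  have h1 : MvPowerSeries.coeff (raisedContent μ j) (schur ℕ μ) = 1 :=
    kostka_raisedContent hμ j
  have hi := i.isLt
  refine congrArg (Sigma.mk (raisedContent μ j)) (Fin.ext ?_)
  change (i : ℕ) = 0
  omega

theorem sum_totalExponent {g : MvPowerSeries ℕ ℕ} (e : MonomialIndex g →₀ ℕ) (t : ℕ) :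
    ∑ x ∈ Finset.range t, totalExponent e x =
      ∑ p ∈ e.support, e p * ∑ x ∈ Finset.range t, p.1 x := by
  simp_rw [totalExponent_apply, Finset.mul_sum]
  exact Finset.sum_comm

section Monomials

variable {lam μ : YoungDiagram} {ι : MonomialIndex (schur ℕ μ) → ℕ}
  {e : MonomialIndex (schur ℕ μ) →₀ ℕ}

theorem card_mul_eq_sum (he : kostka lam (e.mapDomain ι) ≠ 0) (m : ℕ) :
    lam.card * m = ∑ p ∈ e.support, e p * m := by
  rw [← degree_of_kostka_mapDomain_ne_zero he, Finsupp.degree_apply, Finset.sum_mul]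

theorem sum_totalExponent_le (he : kostka lam (e.mapDomain ι) ≠ 0) (t : ℕ) :
    ∑ x ∈ Finset.range t, totalExponent e x ≤
      ∑ x ∈ Finset.range t, lam.card * μ.rowLen x := by
  rw [sum_totalExponent, ← Finset.mul_sum, card_mul_eq_sum he]
  exact Finset.sum_le_sum fun p _ =>
    Nat.mul_le_mul_left _ (sum_le_of_kostka_ne_zero (kostka_ne_zero_of_monomialIndex p) t)

/-- If the first exponents of a product of monomials of `s_μ` are maximal, then they are maximal
in each of its factors. -/
theorem apply_eq_rowLen_of_totalExponent_eq (he : kostka lam (e.mapDomain ι) ≠ 0) {K : ℕ}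
    (h : ∀ x < K, totalExponent e x = lam.card * μ.rowLen x) {p : MonomialIndex (schur ℕ μ)}
    (hp : p ∈ e.support) : ∀ x < K, p.1 x = μ.rowLen x := by
  have hsum : ∀ t ≤ K, ∑ x ∈ Finset.range t, p.1 x = ∑ x ∈ Finset.range t, μ.rowLen x := by
    intro t ht
    have h1 : ∑ x ∈ Finset.range t, totalExponent e x =
        ∑ x ∈ Finset.range t, lam.card * μ.rowLen x :=
      Finset.sum_congr rfl fun x hx => h x (by rw [Finset.mem_range] at hx; omega)
    rw [sum_totalExponent, ← Finset.mul_sum, card_mul_eq_sum he,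
      Finset.sum_eq_sum_iff_of_le fun p _ => Nat.mul_le_mul_left _
        (sum_le_of_kostka_ne_zero (kostka_ne_zero_of_monomialIndex p) t)] at h1
    exact Nat.eq_of_mul_eq_mul_left (Nat.pos_of_ne_zero (Finsupp.mem_support_iff.1 hp)) (h1 p hp)
  intro x hx
  have h1 := hsum (x + 1) hx
  rw [Finset.sum_range_succ, Finset.sum_range_succ, hsum x hx.le] at h1
  omega

open Classical in
/-- A monomial of `s_μ` other than `x ^ μ`, with maximal exponents before the last part of `μ`,
loses at least one unit at the last part. -/
theorem apply_lastRow_le (hμ : μ ≠ ⊥) (p : MonomialIndex (schur ℕ μ))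
    (h : ∀ x < μ.lastRow, p.1 x = μ.rowLen x) :
    p.1 μ.lastRow ≤ μ.rowLen μ.lastRow - 1 + if p = raisedIndex hμ 0 then 1 else 0 := by
  have hk := kostka_ne_zero_of_monomialIndex p
  have hpos := μ.rowLen_lastRow_pos hμ
  have hle : p.1 μ.lastRow ≤ μ.rowLen μ.lastRow := by
    have h1 := sum_le_of_kostka_ne_zero hk (μ.lastRow + 1)
    have h2 : ∑ x ∈ Finset.range μ.lastRow, p.1 x = ∑ x ∈ Finset.range μ.lastRow, μ.rowLen x :=
      Finset.sum_congr rfl fun x hx => h x (Finset.mem_range.1 hx)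
    rw [Finset.sum_range_succ, Finset.sum_range_succ] at h1
    omega
  split_ifs with hp
  · omega
  · by_contra hlt
    obtain ⟨j, hj⟩ := exists_eq_raisedContent hμ (degree_eq_of_kostka_ne_zero hk) h (by omega)
    have hj0 : j = 0 := by
      by_contra hj0
      rw [hj, raisedContent_lastRow, if_neg hj0] at hlt
      omega
    rw [hj0] at hj
    exact hp (eq_raisedIndex hμ hj)

open Classical in
theorem card_mul_add_eq_sum (hμ : μ ≠ ⊥) (he : kostka lam (e.mapDomain ι) ≠ 0) :
    lam.card * (μ.rowLen μ.lastRow - 1) + e (raisedIndex hμ 0) =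
      ∑ p ∈ e.support,
        e p * (μ.rowLen μ.lastRow - 1 + if p = raisedIndex hμ 0 then 1 else 0) := by
  simp_rw [mul_add]
  rw [Finset.sum_add_distrib, ← card_mul_eq_sum he]
  congr 1
  simp only [mul_ite, mul_one, mul_zero]
  rw [Finset.sum_ite_eq']
  split_ifs with h
  · rfl
  · exact Finsupp.notMem_support_iff.1 h

/-- No term of `s_μ` is used more than `λ_0` times: as an entry of a tableau of shape `lam`, it
occurs at most once in each column. -/
theorem apply_le_rowLen_zero (hι : ι.Injective) (he : kostka lam (e.mapDomain ι) ≠ 0)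
    (p : MonomialIndex (schur ℕ μ)) : e p ≤ lam.rowLen 0 := by
  rw [← Finsupp.mapDomain_apply hι e p]
  exact apply_le_of_kostka_ne_zero he _

theorem totalExponent_lastRow_le (hμ : μ ≠ ⊥) (hι : ι.Injective)
    (he : kostka lam (e.mapDomain ι) ≠ 0)
    (h : ∀ x < μ.lastRow, totalExponent e x = leadingPart lam μ x) :
    totalExponent e μ.lastRow ≤ leadingPart lam μ μ.lastRow := by
  classical
  have h' : ∀ x < μ.lastRow, totalExponent e x = lam.card * μ.rowLen x := fun x hx => by
    rw [h x hx, leadingPart_of_lt hμ hx]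
  rw [leadingPart_lastRow hμ, totalExponent_apply]
  calc _ ≤ _ := Finset.sum_le_sum fun p hp => Nat.mul_le_mul_left (e p)
        (apply_lastRow_le hμ p (apply_eq_rowLen_of_totalExponent_eq he h' hp))
    _ = _ := (card_mul_add_eq_sum hμ he).symm
    _ ≤ _ := Nat.add_le_add_left (apply_le_rowLen_zero hι he _) _

theorem totalExponent_mapDomain_raisedIndex (hμ : μ ≠ ⊥) (d : ℕ →₀ ℕ) (x : ℕ) :
    totalExponent (d.mapDomain (raisedIndex hμ)) x =
      ∑ j ∈ d.support, d j * raisedContent μ j x := by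
  rw [totalExponent_eq_sum, Finsupp.sum_mapDomain_index_inj (raisedIndex_injective hμ),
    Finsupp.sum, Finsupp.finsetSum_apply]
  rfl

theorem totalExponent_mapDomain_raisedIndex_lastRow_add (hμ : μ ≠ ⊥) (d : ℕ →₀ ℕ) {i : ℕ}
    (hi : i ≠ 0) : totalExponent (d.mapDomain (raisedIndex hμ)) (μ.lastRow + i) = d i := by
  rw [totalExponent_mapDomain_raisedIndex]
  simp_rw [raisedContent_lastRow_add μ _ hi, mul_ite, mul_one, mul_zero]
  rw [Finset.sum_ite_eq']
  split_ifs with h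
  · rfl
  · exact (Finsupp.notMem_support_iff.1 h).symm

/-- If the exponents up to the last part of `μ` are maximal, then only the tableaux
`raisedTableau μ j` are used, and the remaining exponents tell how often. -/
theorem exists_eq_mapDomain_raisedIndex (hμ : μ ≠ ⊥) (hι : ι.Injective)
    (he : kostka lam (e.mapDomain ι) ≠ 0)
    (h : ∀ x ≤ μ.lastRow, totalExponent e x = leadingPart lam μ x) :
    ∃ d : ℕ →₀ ℕ, e = d.mapDomain (raisedIndex hμ) ∧ d 0 = lam.rowLen 0 ∧
      (∀ j ≠ 0, d j = totalExponent e (μ.lastRow + j)) ∧ kostka lam d ≠ 0 := by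
  classical
  have h' : ∀ x < μ.lastRow, totalExponent e x = lam.card * μ.rowLen x := fun x hx => by
    rw [h x hx.le, leadingPart_of_lt hμ hx]
  have hp := fun p hp => apply_eq_rowLen_of_totalExponent_eq (p := p) he h' hp
  have hterm : ∀ p ∈ e.support, e p * p.1 μ.lastRow ≤
      e p * (μ.rowLen μ.lastRow - 1 + if p = raisedIndex hμ 0 then 1 else 0) := fun p hpe =>
    Nat.mul_le_mul_left (e p) (apply_lastRow_le hμ p (hp p hpe))
  have hlast := h _ le_rfl
  rw [leadingPart_lastRow hμ, totalExponent_apply] at hlast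
  have h1 := Finset.sum_le_sum hterm
  have h2 := card_mul_add_eq_sum hμ he
  have h3 := apply_le_rowLen_zero hι he (raisedIndex hμ 0)
  -- Both inequalities in the proof of the upper bound are equalities.
  have heq := (Finset.sum_eq_sum_iff_of_le hterm).1 (by omega)
  have hd0 : e (raisedIndex hμ 0) = lam.rowLen 0 := by omega
  have hinj := raisedIndex_injective hμ
  have hsupp : ↑e.support ⊆ Set.range (raisedIndex hμ) := by
    intro p hpe
    have h4 := Nat.eq_of_mul_eq_mul_left
      (Nat.pos_of_ne_zero (Finsupp.mem_support_iff.1 hpe)) (heq p hpe)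
    obtain ⟨j, hj⟩ := exists_eq_raisedContent hμ
      (degree_eq_of_kostka_ne_zero (kostka_ne_zero_of_monomialIndex p)) (hp p hpe) (by omega)
    exact ⟨j, (eq_raisedIndex hμ hj).symm⟩
  have hed := Finsupp.mapDomain_comapDomain _ hinj e hsupp
  refine ⟨e.comapDomain (raisedIndex hμ) hinj.injOn, hed.symm, hd0, fun j hj => ?_, ?_⟩
  · conv_rhs => rw [← hed]
    rw [totalExponent_mapDomain_raisedIndex_lastRow_add hμ _ hj]
  · rw [← hed, ← Finsupp.mapDomain_comp,
      kostka_mapDomain_eq lam _ (hι.comp hinj) Function.injective_id, Finsupp.mapDomain_id] at he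
    exact he

/-- No monomial of the plethysm is lexicographically larger than the claimed leading one. -/
theorem toLex_totalExponent_le (hμ : μ ≠ ⊥) (hι : ι.Injective)
    (he : kostka lam (e.mapDomain ι) ≠ 0) :
    toLex (totalExponent e : ℕ → ℕ) ≤ toLex (leadingPart lam μ) := by
  rw [← not_lt]
  rintro ⟨i, hlt, hi : leadingPart lam μ i < totalExponent e i⟩
  replace hlt : ∀ x < i, leadingPart lam μ x = totalExponent e x := hlt
  rcases lt_trichotomy i μ.lastRow with h | rfl | h
  · have h1 := sum_totalExponent_le he (i + 1)
    have h2 : ∀ x < i + 1, lam.card * μ.rowLen x = leadingPart lam μ x := fun x hx =>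
      (leadingPart_of_lt hμ (by omega)).symm
    have h3 : ∑ x ∈ Finset.range i, leadingPart lam μ x =
        ∑ x ∈ Finset.range i, totalExponent e x :=
      Finset.sum_congr rfl fun x hx => hlt x (Finset.mem_range.1 hx)
    rw [Finset.sum_congr rfl fun x hx => h2 x (Finset.mem_range.1 hx), Finset.sum_range_succ,
      Finset.sum_range_succ] at h1
    omega
  · exact absurd (totalExponent_lastRow_le hμ hι he fun x hx => (hlt x hx).symm) (not_le.2 hi)
  · obtain ⟨d, -, hd0, hd, hk⟩ := exists_eq_mapDomain_raisedIndex hμ hι he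
      fun x hx => (hlt x (by omega)).symm
    refine absurd (toLex_le_of_kostka_ne_zero hk) (not_le.2 ⟨i - μ.lastRow, fun x hx => ?_, ?_⟩)
    · change lam.rowLen x = d x
      rcases Nat.eq_zero_or_pos x with rfl | hx0
      · exact hd0.symm
      · rw [hd x hx0.ne', ← hlt _ (by omega), leadingPart_lastRow_add hμ hx0.ne']
    · change lam.rowLen (i - μ.lastRow) < d (i - μ.lastRow)
      rw [hd _ (by omega), ← leadingPart_lastRow_add hμ (by omega),
        Nat.add_sub_cancel' h.le]
      exact hi

end Monomials

variable {lam μ : YoungDiagram}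

theorem totalExponent_mapDomain_parts (hμ : μ ≠ ⊥) (x : ℕ) :
    totalExponent (lam.parts.mapDomain (raisedIndex hμ)) x = leadingPart lam μ x := by
  have hcard : lam.card = ∑ j ∈ lam.parts.support, lam.parts j := by
    rw [← YoungDiagram.degree_parts, Finsupp.degree_apply]
  rcases lt_trichotomy x μ.lastRow with h | rfl | h
  · rw [totalExponent_mapDomain_raisedIndex, leadingPart_of_lt hμ h, hcard, Finset.sum_mul]
    exact Finset.sum_congr rfl fun j _ => by rw [raisedContent_of_lt j h]
  · rw [totalExponent_mapDomain_raisedIndex, leadingPart_lastRow hμ]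
    simp_rw [raisedContent_lastRow, mul_add]
    rw [Finset.sum_add_distrib, ← Finset.sum_mul, ← hcard]
    congr 1
    simp only [mul_ite, mul_one, mul_zero]
    rw [Finset.sum_ite_eq']
    split_ifs with h
    · rfl
    · exact (Finsupp.notMem_support_iff.1 h).symm
  · obtain ⟨j, rfl⟩ := Nat.exists_eq_add_of_lt h
    rw [add_assoc, totalExponent_mapDomain_raisedIndex_lastRow_add hμ _ (Nat.succ_ne_zero j),
      leadingPart_lastRow_add hμ (Nat.succ_ne_zero j), YoungDiagram.parts_apply]

theorem leadingPart_succ_le (hμ : μ ≠ ⊥) (i : ℕ) :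
    leadingPart lam μ (i + 1) ≤ leadingPart lam μ i := by
  have hanti := μ.rowLen_anti i (i + 1) (Nat.le_succ i)
  have hcard : lam.rowLen 0 ≤ lam.card := by simpa using lam.sum_rowLen_le_card 1
  rcases lt_trichotomy (i + 1) μ.lastRow with h | h | h
  · rw [leadingPart_of_lt hμ h, leadingPart_of_lt hμ (by omega)]
    exact Nat.mul_le_mul_left _ hanti
  · rw [leadingPart_of_lt hμ (show i < μ.lastRow by omega), h, leadingPart_lastRow hμ]
    have hpos := μ.rowLen_lastRow_pos hμ
    calc _ ≤ lam.card * (μ.rowLen μ.lastRow - 1) + lam.card * 1 := by omega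
      _ = lam.card * μ.rowLen μ.lastRow := by
        rw [← mul_add, Nat.sub_add_cancel hpos]
      _ ≤ _ := Nat.mul_le_mul_left _ (h ▸ hanti)
  · obtain ⟨j, hj⟩ := Nat.exists_eq_add_of_le (Nat.le_of_lt_succ h)
    rw [hj, add_assoc, leadingPart_lastRow_add hμ (Nat.succ_ne_zero j)]
    rcases Nat.eq_zero_or_pos j with rfl | hj0
    · rw [add_zero, leadingPart_lastRow hμ]
      exact (lam.rowLen_anti 0 _ (Nat.zero_le _)).trans (Nat.le_add_left _ _)
    · rw [leadingPart_lastRow_add hμ hj0.ne']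
      exact lam.rowLen_anti _ _ (Nat.le_succ j)

theorem exists_rowLen_eq_leadingPart (lam : YoungDiagram) (hμ : μ ≠ ⊥) :
    ∃ ν : YoungDiagram, ∀ i, ν.rowLen i = leadingPart lam μ i := by
  obtain ⟨ν, hν⟩ := YoungDiagram.exists_parts_eq
    (totalExponent (lam.parts.mapDomain (raisedIndex hμ))) fun i => by
      rw [totalExponent_mapDomain_parts, totalExponent_mapDomain_parts]
      exact leadingPart_succ_le hμ i
  exact ⟨ν, fun i => by
    rw [← YoungDiagram.parts_apply, hν, totalExponent_mapDomain_parts]⟩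

/-- The leading monomial arises only from the tableau of shape `lam` and content `lam`. -/
theorem coeff_plethysm_leadingPart (hμ : μ ≠ ⊥) {ν : YoungDiagram}
    (hν : ∀ i, ν.rowLen i = leadingPart lam μ i) :
    MvPowerSeries.coeff ν.parts (plethysm (schur ℤ lam) (schur ℕ μ)) = 1 := by
  have hι := monomialPosition_injective (schur ℕ μ)
  have hinj := raisedIndex_injective hμ
  rw [coeff_plethysm_schur hμ hι,
    finsum_eq_single _ (lam.parts.mapDomain (raisedIndex hμ)) ?_, if_pos ?_,
    ← Finsupp.mapDomain_comp, kostka_mapDomain_eq lam _ (hι.comp hinj) Function.injective_id,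
    Finsupp.mapDomain_id, kostka_parts, Nat.cast_one]
  · ext x
    rw [totalExponent_mapDomain_parts, YoungDiagram.parts_apply, hν]
  · intro e hne
    by_cases he : kostka lam (e.mapDomain (monomialPosition (schur ℕ μ))) = 0
    · rw [he, Nat.cast_zero, ite_self]
    refine if_neg fun hD => hne ?_
    have hx : ∀ x, totalExponent e x = leadingPart lam μ x := fun x => by
      rw [hD, YoungDiagram.parts_apply, hν]
    obtain ⟨d, hed, hd0, hd, -⟩ :=
      exists_eq_mapDomain_raisedIndex hμ hι he fun x _ => hx x
    have : d = lam.parts := by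
      ext j
      rw [YoungDiagram.parts_apply]
      rcases Nat.eq_zero_or_pos j with rfl | hj
      · exact hd0
      · rw [hd j hj.ne', hx, leadingPart_lastRow_add hμ hj.ne']
    rw [hed, this]

theorem proposition5p1 (lam μ : YoungDiagram) (hμ : μ ≠ ⊥) :
    ∃ a : YoungDiagram →₀ ℤ,
      (∀ b : YoungDiagram →₀ ℤ,
        IsSchurExpansion (plethysm (schur ℤ lam) (schur ℕ μ)) b ↔ b = a) ∧
      ∃ ν : YoungDiagram,
        (∀ i, ν.rowLen i = leadingPart lam μ i) ∧
        (∀ κ : YoungDiagram, a κ ≠ 0 → toLex κ.rowLen ≤ toLex ν.rowLen) ∧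
        a ν = 1 := by
  obtain ⟨a, ha⟩ := exists_isSchurExpansion (lam.card * μ.card)
    (plethysm (schur ℤ lam) (schur ℕ μ)) (coeff_mapDomain_swap_plethysm hμ)
    fun _ => degree_of_coeff_plethysm_ne_zero hμ
  obtain ⟨ν, hν⟩ := exists_rowLen_eq_leadingPart lam hμ
  have hmax : ∀ κ : YoungDiagram, a κ ≠ 0 → toLex κ.rowLen ≤ toLex ν.rowLen := by
    intro κ hκ
    obtain ⟨κ', hle, hne⟩ := exists_coeff_parts_ne_zero a hκ
    rw [← ha] at hne
    have hι := monomialPosition_injective (schur ℕ μ)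
    obtain ⟨e, hD, he⟩ := exists_of_coeff_plethysm_ne_zero hμ hι hne
    refine hle.trans ?_
    have h1 := toLex_totalExponent_le hμ hι he
    rw [hD, ← funext hν] at h1
    exact h1
  refine ⟨a, fun b => ⟨fun hb => hb.unique ha, fun hb => hb ▸ ha⟩, ν, hν, hmax, ?_⟩
  rw [← coeff_parts_sum_smul_schur a ν hmax, ← ha]
  exact coeff_plethysm_leadingPart hμ hν
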